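/- Let $X,Y,Z$ be the Pauli matrices, $R_P(\theta)=\exp(-i\theta P/2)$ and $R_{PP'}(\theta)=\exp(-i\theta\,P\otimes P'/2)$. For $A,B\in U(2)$ with $\det A=\det B$, let the matchgate $G(A,B)$ be the two-qubit unitary acting as $A$ on $\mathrm{span}(|00\rangle,|11\rangle)$ and as $B$ on $\mathrm{span}(|01\rangle,|10\rangle)$. Let $G_n$ be the group of $n$-qubit unitaries generated by the matchgates $G(A,B)_{j,j+1}$ on neighbouring qubits and the gates $X_j,Y_j$; its elements are the Gaussian unitaries. For an $n$-qubit unitary $V$, a feasible decomposition is a finite sum $V=\sum_{i} c_iK_i$ with $c_i\in\mathbb C$, $K_i\in G_n$; the Gaussian unitary extent $\xi(V)$ is the minimum of $\|c\|_1^2=(\sum_i|c_i|)^2$ over all feasible decompositions, and a decomposition attaining it is called optimal. Let $U$ be a two-qubit fermionic gate, i.e. a unitary on $\mathbb C^2\otimes\mathbb C^2$ with $[U,Z\otimes Z]=0$. Then there are real numbers $\varphi,t_1,t_2,t_3,t_4,a,b,c$ with $$U=e^{i\varphi}\,(R_Z(t_1)\otimes R_Z(t_2))\,R_{XX}(a)\,R_{YY}(b)\,R_{ZZ}(c)\,(R_Z(t_3)\otimes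 R_Z(t_4)).\qquad(*)$$ Moreover, let $\varphi,t_1,\dots,t_4,a,b,c\in\mathbb R$ be any numbers satisfying $(*)$, let $j\ne k$ be two of $n$ qubits, and let $U_{j,k}$ be the $n$-qubit unitary acting as $U$ on qubits $j,k$ and trivially elsewhere. If $|j-k|=1$, or if $U$ is diagonal, then $$\xi(U_{j,k})=1+|\sin c|,$$ and an optimal decomposition of $U_{j,k}$ into two Gaussian unitaries, with coefficients $\cos(c/2)$ and $-i\sin(c/2)$, is obtained by substituting $R_{ZZ}(c)=\cos(c/2)\,I-i\sin(c/2)\,Z\otimes Z$ in $(*)$. Furthermore, for every $t\in\mathbb N$, the $t$-fold tensor power on $tn$ qubits satisfies $$\xi\big(U_{j,k}^{\otimes t}\big)=(1+|\sin c|)^t,$$ and the $t$-fold tensor product of the decomposition above is an optimal decomposition of $U_{j,k}^{\otimes t}$. -/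

import Mathlib

open scoped Matrix Kronecker

namespace FermionicGates

noncomputable section

/-- Operators on one qubit, in the computational basis. -/
abbrev OneQubitOp := Matrix (Fin 2) (Fin 2) ℂ

/-- Operators on two qubits; the basis vector `|p q⟩` has the index `(p, q)`, so that `A ⊗ₖ B` is
the operator `A ⊗ B`. -/
abbrev TwoQubitOp := Matrix (Fin 2 × Fin 2) (Fin 2 × Fin 2) ℂ

/-- Operators on `n` qubits; the basis vectors are indexed by bit strings of length `n`. -/
abbrev QubitOp (n : ℕ) := Matrix (Fin n → Fin 2) (Fin n → Fin 2) ℂ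

/-- The group of unitary operators on `n` qubits. -/
abbrev QubitUnitary (n : ℕ) := Matrix.unitaryGroup (Fin n → Fin 2) ℂ

/-! ### Pauli operators, rotations, embeddings -/

def pauliX : OneQubitOp := !![0, 1; 1, 0]

def pauliY : OneQubitOp := !![0, -Complex.I; Complex.I, 0]

def pauliZ : OneQubitOp := !![1, 0; 0, -1]

/-- The rotation `R_P(θ) = exp(-i θ P / 2)`. -/
def rot {ι : Type} [Fintype ι] [DecidableEq ι] (P : Matrix ι ι ℂ) (θ : ℝ) : Matrix ι ι ℂ :=
  NormedSpace.exp ((-(Complex.I * (θ : ℂ) / 2)) • P)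

/-- The one-qubit operator `A` applied to qubit `j`, with the identity on all other qubits. -/
def onQubit {n : ℕ} (j : Fin n) (A : OneQubitOp) : QubitOp n :=
  fun x y => if ∀ l, l ≠ j → x l = y l then A (x j) (y j) else 0

/-- For `j ≠ k`: the two-qubit operator `A` applied to the qubits `j` (first tensor factor) and `k`
(second tensor factor), with the identity on all other qubits. -/
def onPair {n : ℕ} (j k : Fin n) (A : TwoQubitOp) : QubitOp n :=
  fun x y => if ∀ l, l ≠ j → l ≠ k → x l = y l then A (x j, x k) (y j, y k) else 0

/-- The tensor product of `t` operators on `n` qubits each, an operator on `t * n` qubits. The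
`s`-th factor acts on the `s`-th block of `n` consecutive qubits: `finProdFinEquiv (s, l)` is
`l + n * s`. -/
def blockTensor {n t : ℕ} (V : Fin t → QubitOp n) : QubitOp (t * n) :=
  fun x y => ∏ s : Fin t,
    V s (fun l => x (finProdFinEquiv (s, l))) (fun l => y (finProdFinEquiv (s, l)))

/-- The tensor power `V^{⊗t}`. -/
def tensorPower {n : ℕ} (t : ℕ) (V : QubitOp n) : QubitOp (t * n) :=
  blockTensor (fun _ : Fin t => V)

/-! ### Fermionic gates and Gaussian unitaries -/

/-- A two-qubit fermionic gate: a unitary that commutes with the parity operator `Z ⊗ Z`. -/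
def IsFermionicGate (U : TwoQubitOp) : Prop :=
  U ∈ Matrix.unitaryGroup (Fin 2 × Fin 2) ℂ ∧ Commute U (pauliZ ⊗ₖ pauliZ)

/-- The two-qubit operator `G(A, B)`, which acts as `A` on the span of `|00⟩, |11⟩` and as `B` on
the span of `|01⟩, |10⟩` (in this order of the basis vectors). -/
def matchgate (A B : OneQubitOp) : TwoQubitOp :=
  fun x y =>
    if x.1 = x.2 ∧ y.1 = y.2 then A x.1 y.1
    else if x.1 ≠ x.2 ∧ y.1 ≠ y.2 then B x.1 y.1
    else 0

/-- The generators of the group of Gaussian unitaries: nearest neighbour matchgates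
`G(A, B)_{j,j+1}` with `A, B ∈ U(2)` and `det A = det B`, and the Pauli gates `X_j`, `Y_j`. -/
def gaussianGenerators (n : ℕ) : Set (QubitUnitary n) :=
  {K | ∃ j k : Fin n, (j : ℕ) + 1 = (k : ℕ) ∧
      ∃ A ∈ Matrix.unitaryGroup (Fin 2) ℂ, ∃ B ∈ Matrix.unitaryGroup (Fin 2) ℂ,
        A.det = B.det ∧ (K : QubitOp n) = onPair j k (matchgate A B)} ∪
  {K | ∃ j : Fin n, (K : QubitOp n) = onQubit j pauliX ∨ (K : QubitOp n) = onQubit j pauliY}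

/-- The group `G_n` of `n`-qubit Gaussian unitaries. -/
def gaussianGroup (n : ℕ) : Subgroup (QubitUnitary n) :=
  Subgroup.closure (gaussianGenerators n)

/-- The operator `K` is an `n`-qubit Gaussian unitary. -/
def IsGaussian {n : ℕ} (K : QubitOp n) : Prop :=
  ∃ g ∈ gaussianGroup n, (g : QubitOp n) = K

/-! ### Unitary extent -/

/-- `V = ∑ i, c i • K i` is a decomposition of `V` into Gaussian unitaries `K i`. -/
def IsFeasible {n : ℕ} (V : QubitOp n) {ι : Type} [Fintype ι] (c : ι → ℂ) (K : ι → QubitOp n) :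
    Prop :=
  (∀ i, IsGaussian (K i)) ∧ V = ∑ i, c i • K i

/-- The Gaussian unitary extent: the least `‖c‖₁²` over the finite decompositions of `V` into
Gaussian unitaries. -/
def unitaryExtent {n : ℕ} (V : QubitOp n) : ℝ :=
  sInf {r : ℝ | ∃ (χ : ℕ) (c : Fin χ → ℂ) (K : Fin χ → QubitOp n),
    IsFeasible V c K ∧ r = (∑ i, ‖c i‖) ^ 2}

/-- `V = ∑ i, c i • K i` is an optimal decomposition: it is feasible and attains the extent. -/
def IsOptimal {n : ℕ} (V : QubitOp n) {ι : Type} [Fintype ι] (c : ι → ℂ) (K : ι → QubitOp n) :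
    Prop :=
  IsFeasible V c K ∧ unitaryExtent V = (∑ i, ‖c i‖) ^ 2

/-! ### The canonical form of a two-qubit fermionic gate -/

/-- The angles `t₁, t₂, t₃, t₄, a, b, c` and the global phase `φ` of the canonical form. -/
structure Angles where
  φ : ℝ
  t₁ : ℝ
  t₂ : ℝ
  t₃ : ℝ
  t₄ : ℝ
  a : ℝ
  b : ℝ
  c : ℝ

/-- `e^{iφ} (R_Z(t₁) ⊗ R_Z(t₂)) R_XX(a) R_YY(b) M (R_Z(t₃) ⊗ R_Z(t₄))`. -/
def dress (p : Angles) (M : TwoQubitOp) : TwoQubitOp :=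
  Complex.exp (Complex.I * (p.φ : ℂ)) •
    ((rot pauliZ p.t₁ ⊗ₖ rot pauliZ p.t₂) * rot (pauliX ⊗ₖ pauliX) p.a *
      rot (pauliY ⊗ₖ pauliY) p.b * M * (rot pauliZ p.t₃ ⊗ₖ rot pauliZ p.t₄))

/-- `e^{iφ} (R_Z(t₁) ⊗ R_Z(t₂)) R_XX(a) R_YY(b) R_ZZ(c) (R_Z(t₃) ⊗ R_Z(t₄))`. -/
def canonicalGate (p : Angles) : TwoQubitOp :=
  dress p (rot (pauliZ ⊗ₖ pauliZ) p.c)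

/-- The coefficients in `R_ZZ(c) = cos(c/2) I - i sin(c/2) Z ⊗ Z`. -/
def rzzCoeff (c : ℝ) : Fin 2 → ℂ :=
  ![((Real.cos (c / 2) : ℝ) : ℂ), -(Complex.I * ((Real.sin (c / 2) : ℝ) : ℂ))]

/-- The operators in `R_ZZ(c) = cos(c/2) I - i sin(c/2) Z ⊗ Z`. -/
def rzzTerm : Fin 2 → TwoQubitOp :=
  ![1, pauliZ ⊗ₖ pauliZ]

end

end FermionicGates

open FermionicGates

/-!
The canonical form and the upper bound on the extent are computations with parity blocks. A
fermionic gate preserves the parity, so it is `matchgate A B` for some `A, B ∈ U(2)`. The Euler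
decompositions of `A` and `B` give the angles, and `c` is the difference of their phases
(`IsFermionicGate.exists_eq_canonicalGate`). Removing the factor `R_ZZ(c)` makes the two
determinants equal, and so does replacing it by `Z ⊗ Z`. Hence both terms of `R_ZZ(c) = cos(c/2) -
i sin(c/2) Z ⊗ Z` are Gaussian on neighbouring qubits; if the gate is diagonal, they are products
of diagonal one-qubit gates, which are Gaussian on any pair of qubits (`isGaussian_onPair_dress`).
The `ℓ¹` norm of the coefficients is `|cos(c/2)| + |sin(c/2)|`, whose square is `1 + |sin c|`.

The lower bound is a duality argument, carried out for all tensor powers at once. Gaussian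
unitaries are *free*: conjugation by them preserves the real span `W` of the Majorana operators
(`IsGaussian.isFree`). The dual witness is the diagonal operator `M = ∏ (1 - i ε Z_j Z_k)`, where
the product is over the pairs of qubits on which the gates act. If `|tr (K M)| ≤ 2 ^ N` for all
free `K`, then pairing `M` with a decomposition bounds its `ℓ¹` norm from below by `|cos(c/2) - ε
sin(c/2)| ^ t`, which is the required value for a suitable sign `ε` (`pow_le_sum_norm`).

The bound on `tr (K M)` follows by induction on the number of factors from `IsBlock.norm_trace_le`:
if `|tr (K M)| ≤ C` for all free `K`, then the same holds for `M (1 + i ε Γ)`, where `Γ = c₀ c₁ c₂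
c₃` is the product of four anticommuting unit vectors of `W`, a *block*, each of which commutes
with `M`. The proof puts `K` in a normal form relative to the block (`IsBlock.exists_normalForm`):
by the singular value decomposition of the compression to the block of the action of `K` on `W`,
one has `K = L E Y R*`, where `L, R` belong to the spin group of the block, `Y` commutes with the
block, and `E` is a product of four half-angle rotations `p i + q i G i` with `p i ^ 2 + q i ^ 2 =
1`, of which `G i` anticommutes with `c i` and commutes with the other block vectors. As
`Γ` is a central involution of the even part of the block algebra, the spin group is a subset of
`ℍ ⊕ Γ ℍ`, so that `R* L` expands in the eight even monomials of the block. Conjugation by `c i` shows that a monomial `g` selects the term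
`q i G i` if it anticommutes with `c i`, and the term `p i` otherwise; the trace against `g` is
therefore at most `C` times a product of four of the numbers `p i, q i`
(`IsBlock.norm_trace_monomial_le`). The monomials `g` and `Γ g` are taken together, and the
Cauchy-Schwarz inequality together with `sum_sq_weights_le_one` gives the bound `C` for the sum.
-/

set_option linter.unusedSectionVars false
set_option linter.unusedSimpArgs false

namespace FermionicGates

/-! ### Majorana spaces and the unitaries that preserve them -/

section MajoranaSpace

variable {A : Type*} [Ring A] [StarRing A] [Algebra ℝ A] [StarModule ℝ A]

/-- A real space of self-adjoint operators whose squares are scalars, such as the real span of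
Majorana operators. -/
structure IsMajoranaSpace (W : Submodule ℝ A) : Prop where
  star_eq : ∀ w ∈ W, star w = w
  sq : ∀ w ∈ W, ∃ r : ℝ, 0 ≤ r ∧ w * w = r • (1 : A)
  definite : ∀ w ∈ W, w * w = 0 → w = 0

/-- The unitaries which act on the Majorana space `W` by conjugation. -/
structure IsFree (W : Submodule ℝ A) (K : A) : Prop where
  unitary : K ∈ unitary A
  conj_mem : ∀ w ∈ W, K * w * star K ∈ W
  star_conj_mem : ∀ w ∈ W, star K * w * K ∈ W

variable {W : Submodule ℝ A} {K L : A}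

theorem IsFree.star_mul_self (h : IsFree W K) : star K * K = 1 := (Unitary.mem_iff.1 h.unitary).1

theorem IsFree.mul_star_self (h : IsFree W K) : K * star K = 1 := (Unitary.mem_iff.1 h.unitary).2

theorem IsFree.one : IsFree W (1 : A) :=
  ⟨one_mem _, fun w hw => by simpa using hw, fun w hw => by simpa using hw⟩

theorem IsFree.mul (hK : IsFree W K) (hL : IsFree W L) : IsFree W (K * L) := by
  refine ⟨mul_mem hK.unitary hL.unitary, fun w hw => ?_, fun w hw => ?_⟩
  · have := hK.conj_mem _ (hL.conj_mem w hw)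
    simpa [mul_assoc] using this
  · have := hL.star_conj_mem _ (hK.star_conj_mem w hw)
    simpa [mul_assoc] using this

theorem IsFree.star (hK : IsFree W K) : IsFree W (star K) :=
  ⟨Unitary.star_mem hK.unitary, fun w hw => by simpa using hK.star_conj_mem w hw,
    fun w hw => by simpa using hK.conj_mem w hw⟩

theorem IsMajoranaSpace.anticomm (hW : IsMajoranaSpace W) {x y : A} (hx : x ∈ W) (hy : y ∈ W) :
    ∃ r : ℝ, x * y + y * x = r • (1 : A) := by
  obtain ⟨a, -, ha⟩ := hW.sq x hx
  obtain ⟨b, -, hb⟩ := hW.sq y hy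
  obtain ⟨c, -, hc⟩ := hW.sq _ (W.add_mem hx hy)
  refine ⟨c - a - b, ?_⟩
  rw [sub_smul, sub_smul, ← ha, ← hb, ← hc]
  noncomm_ring

/-- A unit vector of the Majorana space is a unitary that acts on it by the negative of a
reflection. -/
theorem IsMajoranaSpace.isFree (hW : IsMajoranaSpace W) {w : A} (hw : w ∈ W) (h1 : w * w = 1) :
    IsFree W w := by
  have key : ∀ x ∈ W, w * x * w ∈ W := by
    intro x hx
    obtain ⟨r, hr⟩ := hW.anticomm hw hx
    have : w * x * w = r • w - x := by
      rw [eq_sub_of_add_eq hr, sub_mul, mul_assoc, h1]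
      simp
    rw [this]
    exact W.sub_mem (W.smul_mem _ hw) hx
  have hs := hW.star_eq w hw
  refine ⟨Unitary.mem_iff.2 ⟨?_, ?_⟩, ?_, ?_⟩ <;> rw [hs]
  exacts [h1, h1, key, key]

/-! ### Blocks of four Majorana operators -/

/-- Four anticommuting unit vectors of the Majorana space `W`. -/
structure IsBlock (W : Submodule ℝ A) (c : Fin 4 → A) : Prop where
  mem : ∀ i, c i ∈ W
  sq : ∀ i, c i * c i = 1
  anti : ∀ i j, i ≠ j → c i * c j = -(c j * c i)

/-- The product of the four Majorana operators of a block. -/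
def blockParity (c : Fin 4 → A) : A := c 0 * c 1 * c 2 * c 3

/-- The real linear combination of the block operators with coefficient vector `v`. -/
def vec (c : Fin 4 → A) (v : EuclideanSpace ℝ (Fin 4)) : A := ∑ i, v i • c i

variable {c : Fin 4 → A}

theorem vec_add (v w : EuclideanSpace ℝ (Fin 4)) : vec c (v + w) = vec c v + vec c w := by
  simp [vec, add_smul, Finset.sum_add_distrib]

theorem vec_smul (r : ℝ) (v : EuclideanSpace ℝ (Fin 4)) : vec c (r • v) = r • vec c v := by
  simp [vec, Finset.smul_sum, smul_smul]

theorem vec_single (i : Fin 4) : vec c (EuclideanSpace.single i 1) = c i := by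
  simp [vec, Pi.single_apply, ite_smul]

theorem IsBlock.vec_mem (hc : IsBlock W c) (v : EuclideanSpace ℝ (Fin 4)) : vec c v ∈ W :=
  W.sum_mem fun i _ => W.smul_mem _ (hc.mem i)

/-- Rewriting rules that sort the block operators in a product by their indices. -/
theorem IsBlock.normal_order (hc : IsBlock W c) :
    (c 1 * c 0 = -(c 0 * c 1) ∧ c 2 * c 0 = -(c 0 * c 2) ∧ c 3 * c 0 = -(c 0 * c 3) ∧
      c 2 * c 1 = -(c 1 * c 2) ∧ c 3 * c 1 = -(c 1 * c 3) ∧ c 3 * c 2 = -(c 2 * c 3)) ∧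
    (∀ x, c 1 * (c 0 * x) = -(c 0 * (c 1 * x))) ∧ (∀ x, c 2 * (c 0 * x) = -(c 0 * (c 2 * x))) ∧
    (∀ x, c 3 * (c 0 * x) = -(c 0 * (c 3 * x))) ∧ (∀ x, c 2 * (c 1 * x) = -(c 1 * (c 2 * x))) ∧
    (∀ x, c 3 * (c 1 * x) = -(c 1 * (c 3 * x))) ∧ (∀ x, c 3 * (c 2 * x) = -(c 2 * (c 3 * x))) ∧
    (∀ i x, c i * (c i * x) = x) := by
  have h : ∀ i j, i ≠ j → ∀ x, c i * (c j * x) = -(c j * (c i * x)) := by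
    intro i j hij x
    rw [← mul_assoc, hc.anti i j hij, neg_mul, mul_assoc]
  have h2 : ∀ i x, c i * (c i * x) = x := fun i x => by rw [← mul_assoc, hc.sq, one_mul]
  refine ⟨⟨?_, ?_, ?_, ?_, ?_, ?_⟩, ?_, ?_, ?_, ?_, ?_, ?_, h2⟩
  all_goals first | exact hc.anti _ _ (by decide) | exact h _ _ (by decide)

theorem IsBlock.vec_anticomm (hc : IsBlock W c) (v w : EuclideanSpace ℝ (Fin 4)) :
    vec c v * vec c w + vec c w * vec c v = (2 * inner ℝ v w) • (1 : A) := by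
  obtain ⟨⟨h10, h20, h30, h21, h31, h32⟩, -⟩ := hc.normal_order
  simp only [vec, Fin.sum_univ_four, add_mul, mul_add, smul_mul_smul_comm, h10, h20, h30, h21, h31,
    h32, hc.sq, PiLp.inner_apply, RCLike.inner_apply, conj_trivial]
  module

theorem IsBlock.vec_mul_self (hc : IsBlock W c) {v : EuclideanSpace ℝ (Fin 4)} (hv : ‖v‖ = 1) :
    vec c v * vec c v = 1 := by
  have := hc.vec_anticomm v v
  rw [real_inner_self_eq_norm_sq, hv, ← two_smul ℝ] at this
  have h2 := congrArg (fun x => (2⁻¹ : ℝ) • x) this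
  simpa [smul_smul] using h2

/-- The quaternionic structure on the even part of the algebra of `c 0, c 1, c 2`. -/
def IsBlock.basis (hc : IsBlock W c) :
    QuaternionAlgebra.Basis A (-1 : ℝ) 0 (-1) where
  i := c 0 * c 1
  j := c 0 * c 2
  k := c 0 * c 1 * (c 0 * c 2)
  i_mul_i := by
    obtain ⟨⟨h10, h20, h30, h21, h31, h32⟩, k10, k20, k30, k21, k31, k32, kk⟩ := hc.normal_order
    simp [mul_assoc, k10, kk, hc.sq]
  j_mul_j := by
    obtain ⟨⟨h10, h20, h30, h21, h31, h32⟩, k10, k20, k30, k21, k31, k32, kk⟩ := hc.normal_order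
    simp [mul_assoc, k20, kk, hc.sq]
  i_mul_j := rfl
  j_mul_i := by
    obtain ⟨⟨h10, h20, h30, h21, h31, h32⟩, k10, k20, k30, k21, k31, k32, kk⟩ := hc.normal_order
    simp [mul_assoc, k20, k10, kk, h21]

open scoped Quaternion in
/-- The algebra homomorphism from the quaternions to the even part of the block. -/
def IsBlock.quat (hc : IsBlock W c) : ℍ[ℝ] →ₐ[ℝ] A := hc.basis.liftHom

open scoped Quaternion in
theorem IsBlock.quat_apply (hc : IsBlock W c) (x : ℍ[ℝ]) :
    hc.quat x = x.re • (1 : A) + x.imI • (c 0 * c 1) + x.imJ • (c 0 * c 2) +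
      x.imK • (c 0 * c 1 * (c 0 * c 2)) := by
  change hc.basis.lift x = _
  simp [QuaternionAlgebra.Basis.lift, Algebra.algebraMap_eq_smul_one, IsBlock.basis]

open scoped Quaternion in
/-- The spin group of a block: by means of the central involution `blockParity c`, the even part of
the block algebra is a product of two copies of the quaternions, and the two components
`x + y`, `x - y` are required to be unit quaternions. -/
def IsBlock.Spin (hc : IsBlock W c) (L : A) : Prop :=
  ∃ x y : ℍ[ℝ], ‖x + y‖ = 1 ∧ ‖x - y‖ = 1 ∧ L = hc.quat x + blockParity c * hc.quat y

theorem IsBlock.blockParity_mul_self (hc : IsBlock W c) : blockParity c * blockParity c = 1 := by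
  obtain ⟨⟨h10, h20, h30, h21, h31, h32⟩, k10, k20, k30, k21, k31, k32, kk⟩ := hc.normal_order
  simp [blockParity, mul_assoc, k10, k20, k30, k21, k31, k32, kk, hc.sq]

theorem IsBlock.blockParity_anti (hc : IsBlock W c) (i : Fin 4) :
    c i * blockParity c = -(blockParity c * c i) := by
  obtain ⟨⟨h10, h20, h30, h21, h31, h32⟩, k10, k20, k30, k21, k31, k32, kk⟩ := hc.normal_order
  fin_cases i <;>
  simp [blockParity, mul_assoc, k10, k20, k30, k21, k31, k32, kk, hc.sq, h10, h20, h30, h21, h31,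
    h32]

open scoped Quaternion in
theorem IsBlock.quat_comm (hc : IsBlock W c) (x : ℍ[ℝ]) :
    hc.quat x * blockParity c = blockParity c * hc.quat x := by
  obtain ⟨⟨h10, h20, h30, h21, h31, h32⟩, k10, k20, k30, k21, k31, k32, kk⟩ := hc.normal_order
  simp only [hc.quat_apply, blockParity, mul_add, add_mul, smul_mul_assoc, mul_smul_comm]
  simp [mul_assoc, k10, k20, k30, k21, k31, k32, kk, hc.sq, h10, h20, h30, h21, h31,
    h32]

theorem IsBlock.Spin.mul {hc : IsBlock W c} (hK : hc.Spin K) (hL : hc.Spin L) :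
    hc.Spin (K * L) := by
  obtain ⟨x, y, hp, hm, rfl⟩ := hK
  obtain ⟨x', y', hp', hm', rfl⟩ := hL
  refine ⟨x * x' + y * y', x * y' + y * x', ?_, ?_, ?_⟩
  · rw [show x * x' + y * y' + (x * y' + y * x') = (x + y) * (x' + y') by noncomm_ring, norm_mul,
      hp, hp', one_mul]
  · rw [show x * x' + y * y' - (x * y' + y * x') = (x - y) * (x' - y') by noncomm_ring, norm_mul,
      hm, hm', one_mul]
  · have h1 := hc.quat_comm
    have h2 := hc.blockParity_mul_self
    simp only [map_add, map_mul, add_mul, mul_add]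
    rw [← mul_assoc (hc.quat x), h1, mul_assoc (blockParity c) _ (blockParity c * _),
      ← mul_assoc (hc.quat y) (blockParity c), h1, ← mul_assoc (blockParity c),
      ← mul_assoc (blockParity c) (blockParity c), h2]
    noncomm_ring

theorem IsBlock.Spin.star {hc : IsBlock W c} (hW : IsMajoranaSpace W) (hK : hc.Spin K) :
    hc.Spin (star K) := by
  obtain ⟨x, y, hp, hm, rfl⟩ := hK
  have hs : ∀ i, Star.star (c i) = c i := fun i => hW.star_eq _ (hc.mem i)
  have hq : ∀ z, Star.star (hc.quat z) = hc.quat (Star.star z) := by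
    intro z
    obtain ⟨⟨h10, h20, h30, h21, h31, h32⟩, k10, k20, k30, k21, k31, k32, kk⟩ := hc.normal_order
    simp [hc.quat_apply, hs, mul_assoc, k10, k20, k30, k21, k31, k32, kk, hc.sq, h10, h20, h21]
  have hG : Star.star (blockParity c) = blockParity c := by
    obtain ⟨⟨h10, h20, h30, h21, h31, h32⟩, k10, k20, k30, k21, k31, k32, kk⟩ := hc.normal_order
    simp [blockParity, hs, mul_assoc, k10, k20, k30, k21, k31, k32, kk, hc.sq, h10, h20, h21, h30,
      h31, h32]
  refine ⟨Star.star x, Star.star y, ?_, ?_, ?_⟩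
  · rw [← star_add, norm_star, hp]
  · rw [← star_sub, norm_star, hm]
  · rw [star_add, star_mul, hq, hq, hG, hc.quat_comm]

theorem IsBlock.Spin.one {hc : IsBlock W c} : hc.Spin (1 : A) :=
  ⟨1, 0, by simp, by simp, by simp⟩

open scoped Quaternion in
/-- A product of two unit vectors of a block belongs to its spin group. -/
theorem IsBlock.spin_vec_mul (hc : IsBlock W c) (hW : IsMajoranaSpace W)
    {v w : EuclideanSpace ℝ (Fin 4)}
    (hv : ‖v‖ = 1) (hw : ‖w‖ = 1) : hc.Spin (vec c v * vec c w) := by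
  -- it suffices to consider `u * c 0`, because `v * w = (v * c 0) * (w * c 0)*`
  have key : ∀ u : EuclideanSpace ℝ (Fin 4), ‖u‖ = 1 → hc.Spin (vec c u * c 0) := by
    intro u hu
    have hu2 : u 0 ^ 2 + u 1 ^ 2 + u 2 ^ 2 + u 3 ^ 2 = 1 := by
      have := real_inner_self_eq_norm_sq u
      rw [hu, PiLp.inner_apply, Fin.sum_univ_four] at this
      simpa [← pow_two] using this
    obtain ⟨x, hx0, hx1, hx2, hx3⟩ : ∃ x : ℍ[ℝ], x.re = u 0 ∧ x.imI = -u 1 ∧ x.imJ = -u 2 ∧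
        x.imK = 0 := ⟨⟨u 0, -u 1, -u 2, 0⟩, rfl, rfl, rfl, rfl⟩
    obtain ⟨y, hy0, hy1, hy2, hy3⟩ : ∃ y : ℍ[ℝ], y.re = 0 ∧ y.imI = 0 ∧ y.imJ = 0 ∧
        y.imK = -u 3 := ⟨⟨0, 0, 0, -u 3⟩, rfl, rfl, rfl, rfl⟩
    refine ⟨x, y, ?_, ?_, ?_⟩
    · rw [← sq_eq_sq₀ (norm_nonneg _) zero_le_one, pow_two, ← Quaternion.normSq_eq_norm_mul_self,
        Quaternion.normSq_def']
      simp [hx0, hx1, hx2, hx3, hy0, hy1, hy2, hy3]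
      linarith
    · rw [← sq_eq_sq₀ (norm_nonneg _) zero_le_one, pow_two, ← Quaternion.normSq_eq_norm_mul_self,
        Quaternion.normSq_def']
      simp [hx0, hx1, hx2, hx3, hy0, hy1, hy2, hy3]
      linarith
    · obtain ⟨⟨h10, h20, h30, h21, h31, h32⟩, k10, k20, k30, k21, k31, k32, kk⟩ := hc.normal_order
      rw [hc.quat_apply, hc.quat_apply]
      simp [hx0, hx1, hx2, hx3, hy0, hy1, hy2, hy3, vec, Fin.sum_univ_four, blockParity, add_mul,
        mul_assoc, k10, k20, k30, k21, k31, k32, kk, hc.sq, h10, h20, h30, h21, h31, h32]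
  have h := (key v hv).mul ((key w hw).star hW)
  have hs : ∀ i, Star.star (c i) = c i := fun i => hW.star_eq _ (hc.mem i)
  rw [star_mul, hs, hW.star_eq _ (hc.vec_mem w), mul_assoc, ← mul_assoc (c 0), hc.sq, one_mul] at h
  exact h

/-- The spin group of a block commutes with everything that anticommutes with the block. -/
theorem IsBlock.Spin.comm_of_anti {hc : IsBlock W c} (hL : hc.Spin L) {d : A}
    (hd : ∀ i, c i * d = -(d * c i)) : L * d = d * L := by
  obtain ⟨x, y, -, -, rfl⟩ := hL
  have hd' : ∀ i z, c i * (d * z) = -(d * (c i * z)) := fun i z => by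
    rw [← mul_assoc, hd, neg_mul, mul_assoc]
  simp only [hc.quat_apply, blockParity, mul_add, add_mul, smul_mul_assoc, mul_smul_comm]
  simp [mul_assoc, hd, hd']

/-- The spin group of a block commutes with everything that commutes with the block. -/
theorem IsBlock.Spin.comm_of_comm {hc : IsBlock W c} (hL : hc.Spin L) {d : A}
    (hd : ∀ i, c i * d = d * c i) : L * d = d * L := by
  obtain ⟨x, y, -, -, rfl⟩ := hL
  have hd' : ∀ i z, c i * (d * z) = d * (c i * z) := fun i z => by
    rw [← mul_assoc, hd, mul_assoc]
  simp only [hc.quat_apply, blockParity, mul_add, add_mul, smul_mul_assoc, mul_smul_comm]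
  simp [mul_assoc, hd, hd']

end MajoranaSpace

section Decomposition

/-! ### Lifting rotations of a block, and the normal form of a free unitary -/

/-- A singular value decomposition of an endomorphism of `ℝ⁴`; the two orthonormal bases are the
images of the standard basis under `ρ₁` and `ρ₂`. -/
theorem exists_singularValueDecomposition
    (T : EuclideanSpace ℝ (Fin 4) →ₗ[ℝ] EuclideanSpace ℝ (Fin 4)) :
    ∃ (ρ₁ ρ₂ : EuclideanSpace ℝ (Fin 4) ≃ₗᵢ[ℝ] EuclideanSpace ℝ (Fin 4)) (σ : Fin 4 → ℝ),
      (∀ i, 0 ≤ σ i) ∧ ∀ i, T (ρ₂ (EuclideanSpace.single i 1)) =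
        σ i • ρ₁ (EuclideanSpace.single i 1) := by
  have hn : Module.finrank ℝ (EuclideanSpace ℝ (Fin 4)) = 4 := by simp
  set b := T.isSymmetric_adjoint_comp_self.eigenvectorBasis hn with hb
  have horth : ∀ i j, i ≠ j → inner ℝ (T (b i)) (T (b j)) = 0 := by
    intro i j hij
    have h := T.isSymmetric_adjoint_comp_self.apply_eigenvectorBasis hn j
    rw [← hb, LinearMap.comp_apply] at h
    rw [← LinearMap.adjoint_inner_right, h, inner_smul_right, b.inner_eq_zero hij, mul_zero]
  set s : Set (Fin 4) := {i | T (b i) ≠ 0}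
  obtain ⟨u, hu⟩ := Orthonormal.exists_orthonormalBasis_extension_of_card_eq (𝕜 := ℝ)
    (ι := Fin 4) (by simp) (v := fun i => ‖T (b i)‖⁻¹ • T (b i)) (s := s) (by
      refine ⟨fun ⟨i, hi⟩ => ?_, fun ⟨i, hi⟩ ⟨j, hj⟩ hij => ?_⟩
      · have : ‖T (b i)‖ ≠ 0 := norm_ne_zero_iff.2 hi
        simp [norm_smul, this]
      · have : i ≠ j := fun h => hij (by simp [h])
        simp [inner_smul_left, inner_smul_right, horth i j this])
  refine ⟨u.repr.symm, b.repr.symm, fun i => ‖T (b i)‖, fun i => norm_nonneg _, fun i => ?_⟩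
  rw [OrthonormalBasis.repr_symm_single, OrthonormalBasis.repr_symm_single]
  by_cases hi : T (b i) = 0
  · simp [hi]
  · rw [hu i hi, smul_smul, mul_inv_cancel₀ (norm_ne_zero_iff.2 hi), one_smul]

variable {A : Type*} [Ring A] [StarRing A] [Algebra ℝ A] [StarModule ℝ A]
variable {W : Submodule ℝ A} {K L : A} {c : Fin 4 → A}

/-- Conjugation by a unit vector is the negative of the reflection in its orthogonal complement. -/
theorem IsBlock.exists_reflection (hc : IsBlock W c) (x : EuclideanSpace ℝ (Fin 4)) (hx : x ≠ 0) :
    ∃ u : EuclideanSpace ℝ (Fin 4), ‖u‖ = 1 ∧ ∀ z,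
      vec c u * vec c z = -(vec c ((ℝ ∙ x)ᗮ.reflection z) * vec c u) := by
  have hx' : ‖x‖ ≠ 0 := norm_ne_zero_iff.2 hx
  have hu : ‖‖x‖⁻¹ • x‖ = 1 := by simp [norm_smul, hx']
  obtain ⟨u, hux⟩ : ∃ u, u = ‖x‖⁻¹ • x := ⟨_, rfl⟩
  rw [← hux] at hu
  refine ⟨u, hu, fun z => ?_⟩
  have hr : (ℝ ∙ x)ᗮ.reflection z = z + (-2 * inner ℝ u z) • u := by
    rw [Submodule.reflection_orthogonal_apply, Submodule.reflection_singleton_apply]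
    simp only [hux, inner_smul_left, smul_smul, two_smul]
    simp only [conj_trivial, RCLike.ofReal_real_eq_id, id]
    rw [← add_smul, neg_sub, sub_eq_add_neg, ← neg_smul]
    congr 2
    field_simp
    norm_num
  rw [hr, vec_add, vec_smul, add_mul, smul_mul_assoc, hc.vec_mul_self hu,
    eq_sub_of_add_eq (hc.vec_anticomm u z)]
  module

/-- Every orthogonal transformation of a block lifts to the spin group, up to the sign of the image
of the first basis vector. -/
theorem IsBlock.exists_lift (hc : IsBlock W c) (hW : IsMajoranaSpace W)
    (ρ : EuclideanSpace ℝ (Fin 4) ≃ₗᵢ[ℝ] EuclideanSpace ℝ (Fin 4)) :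
    ∃ (L : A) (η : Fin 4 → ℝ), hc.Spin L ∧ IsFree W L ∧ (∀ j, η j * η j = 1) ∧
      (∀ j, j ≠ 0 → η j = 1) ∧
      ∀ j, L * c j = η j • (vec c (ρ (EuclideanSpace.single j 1)) * L) := by
  -- by the Cartan-Dieudonné theorem, `ρ` is a product of reflections
  obtain ⟨l, -, rfl⟩ := ρ.reflections_generate_dim
  induction l with
  | nil =>
    refine ⟨1, fun _ => 1, Spin.one, IsFree.one, by simp, by simp, fun j => ?_⟩
    simp [vec_single]
  | cons x l ih =>
    obtain ⟨L, η, hS, hF, h1, hη, h⟩ := ih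
    simp only [List.map_cons, List.prod_cons, LinearIsometryEquiv.coe_mul, Function.comp_apply]
    generalize (l.map fun v => (ℝ ∙ v)ᗮ.reflection).prod = ρ at h ⊢
    by_cases hx : x = 0
    · have h0 : ∀ z, (ℝ ∙ x)ᗮ.reflection z = z := fun z => by
        rw [Submodule.reflection_orthogonal_apply, Submodule.reflection_singleton_apply, hx]
        simp
      refine ⟨L, η, hS, hF, h1, hη, fun j => ?_⟩
      rw [h, h0]
    obtain ⟨u, hu, hrefl⟩ := hc.exists_reflection x hx
    -- the factor `c 0` keeps the lift even; conjugation by it negates `c j` for `j ≠ 0`, which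
    -- cancels the sign in `hrefl`, so that only the image of `c 0` changes its sign
    refine ⟨vec c u * L * c 0, fun j => if j = 0 then -η 0 else 1, ?_, ?_, ?_, ?_, ?_⟩
    · have : vec c u * L * c 0 =
          vec c u * vec c (η 0 • ρ (EuclideanSpace.single 0 1)) * L := by
        rw [mul_assoc, h, vec_smul]
        simp only [mul_smul_comm, smul_mul_assoc, mul_assoc]
      rw [this]
      refine (hc.spin_vec_mul hW hu ?_).mul hS
      rw [norm_smul, LinearIsometryEquiv.norm_map, PiLp.norm_single, norm_one, mul_one,
        ← sq_eq_sq₀ (norm_nonneg _) zero_le_one, Real.norm_eq_abs, sq_abs, pow_two, h1, one_pow]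
    · exact ((hW.isFree (hc.vec_mem u) (hc.vec_mul_self hu)).mul hF).mul
        (hW.isFree (hc.mem 0) (hc.sq 0))
    · intro j
      by_cases hj : j = 0 <;> simp [hj, h1]
    · intro j hj
      simp [hj]
    · intro j
      by_cases hj : j = 0
      · subst hj
        simp only [if_true]
        have e : vec c u * (L * c 0) =
            -η 0 • (vec c ((ℝ ∙ x)ᗮ.reflection (ρ (EuclideanSpace.single 0 1))) *
              (vec c u * L)) := by
          rw [h, mul_smul_comm, ← mul_assoc, hrefl]
          simp [mul_assoc]
        simpa only [smul_mul_assoc, mul_assoc] using congrArg (· * c 0) e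
      · simp only [hj, if_false, one_smul]
        rw [mul_assoc (vec c u * L), hc.anti 0 j (Ne.symm hj), mul_neg, ← mul_assoc, mul_assoc _ L,
          h, hη j hj, one_smul, ← mul_assoc, hrefl]
        simp only [neg_mul, mul_assoc, neg_neg]

/-- The half-angle rotation that takes `c i` to the unit vector `σ • c i + d`, where `d` is
orthogonal to the block. For `d = 0` and `σ = -1` there is no plane to rotate in; the product of the
other three block vectors then replaces the rotation, and it need not commute with vectors
orthogonal to the block. -/
theorem IsBlock.exists_half_rotation [Nontrivial A] (hc : IsBlock W c) (hW : IsMajoranaSpace W)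
    (i : Fin 4) {σ : ℝ}
    {d : A} (hd : d ∈ W) (hanti : ∀ k, c k * d = -(d * c k))
    (hsq : (σ • c i + d) * (σ • c i + d) = 1) :
    ∃ (p q : ℝ) (G : A), 0 ≤ p ∧ 0 ≤ q ∧ p ^ 2 + q ^ 2 = 1 ∧ IsFree W G ∧
      (∀ k, k ≠ i → c k * G = G * c k) ∧ c i * G = -(G * c i) ∧ IsFree W (p • (1 : A) + q • G) ∧
      (p • (1 : A) + q • G) * c i = (σ • c i + d) * (p • (1 : A) + q • G) ∧
      (σ ≠ -1 → ∀ e, d * e = -(e * d) → (∀ k, c k * e = -(e * c k)) →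
        (p • (1 : A) + q • G) * e = e * (p • (1 : A) + q • G)) := by
  obtain ⟨r, hr0, hr⟩ := hW.sq d hd
  have hσr : σ ^ 2 + r = 1 := by
    have : (σ • c i + d) * (σ • c i + d) = (σ ^ 2 + r) • (1 : A) := by
      simp only [add_mul, mul_add, smul_mul_smul_comm, hc.sq, smul_mul_assoc, mul_smul_comm,
        hanti, hr]
      module
    rw [this, ← sub_eq_zero] at hsq
    have h2 : (σ ^ 2 + r - 1) • (1 : A) = 0 := by rw [sub_smul, one_smul, hsq]
    simpa [sub_eq_zero] using h2
  by_cases hd0 : d = 0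
  · subst hd0
    have hr' : r = 0 := by simpa using hr.symm
    have hG := hc.blockParity_anti
    have hGG := hc.blockParity_mul_self
    have hGF : IsFree W (blockParity c) :=
      (((hW.isFree (hc.mem 0) (hc.sq 0)).mul (hW.isFree (hc.mem 1) (hc.sq 1))).mul
        (hW.isFree (hc.mem 2) (hc.sq 2))).mul (hW.isFree (hc.mem 3) (hc.sq 3))
    have hF : IsFree W (blockParity c * c i) := hGF.mul (hW.isFree (hc.mem i) (hc.sq i))
    have hc1 : ∀ k, k ≠ i → c k * (blockParity c * c i) = blockParity c * c i * c k := by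
      intro k hk
      rw [← mul_assoc, hG, neg_mul, mul_assoc, hc.anti k i hk, mul_neg, neg_neg, mul_assoc]
    have hc2 : c i * (blockParity c * c i) = -(blockParity c * c i * c i) := by
      rw [← mul_assoc, hG, neg_mul]
    have hs : (σ - 1) * (σ + 1) = 0 := by linear_combination hσr - hr'
    rcases mul_eq_zero.1 hs with h | h
    · have hσ : σ = 1 := by linarith
      refine ⟨1, 0, blockParity c * c i, zero_le_one, le_rfl, by norm_num, hF, hc1, hc2, ?_, ?_, ?_⟩
      · simpa using IsFree.one
      · simp [hσ]
      · intro _ e _ _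
        simp
    · have hσ : σ = -1 := by linarith
      refine ⟨0, 1, blockParity c * c i, le_rfl, zero_le_one, by norm_num, hF, hc1, hc2, ?_, ?_, ?_⟩
      · simpa using hF
      · simp only [hσ, zero_smul, one_smul, zero_add, add_zero, neg_smul, neg_mul, hc2, neg_neg]
      · intro h
        exact absurd hσ h
  · have hrpos : 0 < r := by
      rcases hr0.lt_or_eq with h | h
      · exact h
      · exact absurd (hW.definite d hd (by rw [hr, ← h, zero_smul])) hd0
    have hσ1 : σ ≤ 1 := by nlinarith
    have hσ2 : -1 ≤ σ := by nlinarith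
    -- `σ` is the cosine of the angle, `p` and `q` are the cosine and sine of its half
    set p := √((1 + σ) / 2)
    set q := √((1 - σ) / 2)
    have hp : p * p = (1 + σ) / 2 := Real.mul_self_sqrt (by linarith)
    have hq : q * q = (1 - σ) / 2 := Real.mul_self_sqrt (by linarith)
    have hs : √r * √r = r := Real.mul_self_sqrt hr0
    have hs0 : √r ≠ 0 := (Real.sqrt_pos.2 hrpos).ne'
    have hpq : 2 * (p * q) = √r := by
      rw [← sq_eq_sq₀ (by positivity) (by positivity)]
      calc (2 * (p * q)) ^ 2 = 4 * (p * p) * (q * q) := by ring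
        _ = √r ^ 2 := by rw [hp, hq, pow_two, hs]; linear_combination -hσr
    set d' := (√r)⁻¹ • d
    have hd' : d' * d' = 1 := by
      simp only [d', smul_mul_smul_comm, hr, smul_smul]
      rw [← mul_inv, hs, inv_mul_cancel₀ hrpos.ne', one_smul]
    have hdd' : d = √r • d' := by simp [d', smul_smul, hs0]
    have hd'W : d' ∈ W := W.smul_mem _ hd
    have hanti' : ∀ k, c k * d' = -(d' * c k) := by
      intro k
      simp [d', hanti]
    have hfd := hW.isFree hd'W hd'
    have hfc := hW.isFree (hc.mem i) (hc.sq i)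
    have hfv : IsFree W (p • c i + q • d') := by
      refine hW.isFree (W.add_mem (W.smul_mem _ (hc.mem i)) (W.smul_mem _ hd'W)) ?_
      simp only [add_mul, mul_add, smul_mul_smul_comm, hc.sq, hanti', hd', hp, hq, mul_comm q p]
      module
    refine ⟨p, q, d' * c i, Real.sqrt_nonneg _, Real.sqrt_nonneg _, ?_, hfd.mul hfc, ?_, ?_, ?_,
      ?_, ?_⟩
    · rw [pow_two, pow_two, hp, hq]; ring
    · intro k hk
      rw [← mul_assoc, hanti', neg_mul, mul_assoc, hc.anti k i hk, mul_neg, neg_neg, mul_assoc]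
    · rw [← mul_assoc, hanti', neg_mul]
    · have : p • (1 : A) + q • (d' * c i) = (p • c i + q • d') * c i := by
        simp [add_mul, hc.sq]
      rw [this]
      exact hfv.mul hfc
    · have h1 : σ = p * p - q * q := by rw [hp, hq]; ring
      have h2 : c i * (d' * c i) = -d' := by
        rw [← mul_assoc, hanti', neg_mul, mul_assoc, hc.sq, mul_one]
      have h3 : d' * (d' * c i) = c i := by rw [← mul_assoc, hd', one_mul]
      have h4 : d' * c i * c i = d' := by rw [mul_assoc, hc.sq, mul_one]
      have h5 : 1 = p * p + q * q := by rw [hp, hq]; ring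
      rw [hdd', ← hpq]
      simp only [add_mul, mul_add, smul_mul_assoc, mul_smul_comm, h2, h3, h4, one_mul, mul_one]
      clear_value p q d'
      have e1 : p = σ * p + 2 * (p * q) * q := by linear_combination p * h5 - p * h1
      have e2 : q = 2 * (p * q) * p - σ * q := by linear_combination q * h5 + q * h1
      calc p • c i + q • d' = (σ * p + 2 * (p * q) * q) • c i + (2 * (p * q) * p - σ * q) • d' := by
            rw [← e1, ← e2]
        _ = _ := by module
    · intro _ e hde he
      have : d' * e = -(e * d') := by simp [d', hde]
      simp only [add_mul, mul_add, smul_mul_assoc, mul_smul_comm, one_mul, mul_one]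
      rw [mul_assoc, he, mul_neg, ← mul_assoc, this, neg_mul, neg_neg, mul_assoc]

/-- A vector of the Majorana space is the sum of a vector of the block and a vector orthogonal to
the block. -/
theorem IsBlock.exists_decomp (hc : IsBlock W c) (hW : IsMajoranaSpace W) {w : A} (hw : w ∈ W) :
    ∃ (a : EuclideanSpace ℝ (Fin 4)) (d : A), d ∈ W ∧ w = vec c a + d ∧
      ∀ k, c k * d = -(d * c k) := by
  choose r hr using fun k => hW.anticomm (hc.mem k) hw
  -- the `k`-th coordinate of the projection to the block is half of the anticommutator with `c k`
  refine ⟨WithLp.toLp 2 (fun k => r k / 2), w - vec c (WithLp.toLp 2 (fun k => r k / 2)),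
    W.sub_mem hw (hc.vec_mem _), by simp, fun k => ?_⟩
  have h1 := hc.vec_anticomm (EuclideanSpace.single k 1) (WithLp.toLp 2 (fun k => r k / 2))
  rw [vec_single] at h1
  rw [eq_neg_iff_add_eq_zero, mul_sub, sub_mul]
  have h2 : inner ℝ (EuclideanSpace.single k (1 : ℝ)) (WithLp.toLp 2 (fun k => r k / 2)) =
      r k / 2 := by
    rw [EuclideanSpace.inner_single_left]
    simp
  rw [h2] at h1
  rw [sub_add_sub_comm, hr, h1, mul_div_cancel₀ _ (two_ne_zero), sub_self]

end Decomposition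

section NormalForm

variable {A : Type*} [Ring A] [StarRing A] [Algebra ℝ A] [StarModule ℝ A]
variable {W : Submodule ℝ A} {K L : A} {c : Fin 4 → A}

/-- A free unitary acts on a block by a linear map, up to vectors orthogonal to the block. -/
theorem IsBlock.exists_compression (hc : IsBlock W c) (hW : IsMajoranaSpace W) (hK : IsFree W K) :
    ∃ (T : EuclideanSpace ℝ (Fin 4) →ₗ[ℝ] EuclideanSpace ℝ (Fin 4))
      (D : EuclideanSpace ℝ (Fin 4) → A), ∀ v, D v ∈ W ∧ (∀ k, c k * D v = -(D v * c k)) ∧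
        K * vec c v = (vec c (T v) + D v) * K := by
  choose a d hd had hanti using fun j => hc.exists_decomp hW (hK.conj_mem (c j) (hc.mem j))
  have hKc : ∀ j, K * c j = (vec c (a j) + d j) * K := fun j => by
    rw [← had, mul_assoc, hK.star_mul_self, mul_one]
  refine ⟨{ toFun := fun v => ∑ j, v j • a j
            map_add' := fun v w => by simp [add_smul, Finset.sum_add_distrib]
            map_smul' := fun r v => by simp [Finset.smul_sum, smul_smul] },
    fun v => ∑ j, v j • d j, fun v => ⟨W.sum_mem fun j _ => W.smul_mem _ (hd j), fun k => ?_, ?_⟩⟩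
  · simp [Finset.mul_sum, Finset.sum_mul, hanti]
  · simp only [LinearMap.coe_mk, AddHom.coe_mk, Fin.sum_univ_four, vec_add, vec_smul]
    simp only [vec, Fin.sum_univ_four (f := fun i => v i • c i), mul_add, mul_smul_comm, hKc]
    simp only [add_mul, smul_mul_assoc]
    module

/-- The normal form of a free unitary relative to a block: up to the spin group of the block and a
free unitary that commutes with the block, it is a product of four half-angle rotations. -/
theorem IsBlock.exists_normalForm [Nontrivial A] (hc : IsBlock W c) (hW : IsMajoranaSpace W)
    (hK : IsFree W K) :
    ∃ (L R Y : A) (p q : Fin 4 → ℝ) (G : Fin 4 → A), hc.Spin L ∧ hc.Spin R ∧ IsFree W R ∧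
      IsFree W Y ∧ (∀ i, 0 ≤ p i ∧ 0 ≤ q i ∧ p i ^ 2 + q i ^ 2 = 1) ∧ (∀ i, IsFree W (G i)) ∧
      (∀ i k, k ≠ i → c k * G i = G i * c k) ∧ (∀ i, c i * G i = -(G i * c i)) ∧
      (∀ k, c k * Y = Y * c k) ∧
      K = L * ((p 1 • 1 + q 1 • G 1) * (p 2 • 1 + q 2 • G 2) * (p 3 • 1 + q 3 • G 3) *
        (p 0 • 1 + q 0 • G 0)) * Y * star R := by
  obtain ⟨T, D, hTD⟩ := hc.exists_compression hW hK
  obtain ⟨ρ₁, ρ₂, σ, hσ, hT⟩ := exists_singularValueDecomposition T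
  obtain ⟨L, η, hLS, hLF, hη, hη1, hL⟩ := hc.exists_lift hW ρ₁
  obtain ⟨R, θ, hRS, hRF, hθ, hθ1, hR⟩ := hc.exists_lift hW ρ₂
  -- `X` takes `c i` to `s i • c i + d i`, where `d i` is orthogonal to the block
  set X := star L * K * R with hX
  have hXF : IsFree W X := (hLF.star.mul hK).mul hRF
  set d : Fin 4 → A := fun i => θ i • D (ρ₂ (EuclideanSpace.single i 1)) with hd
  set s : Fin 4 → ℝ := fun i => η i * θ i * σ i with hs
  have hdW : ∀ i, d i ∈ W := fun i => W.smul_mem _ (hTD _).1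
  have hdc : ∀ i k, c k * d i = -(d i * c k) := fun i k => by
    simp [hd, (hTD _).2.1 k]
  have hXc : ∀ i, X * c i = (s i • c i + d i) * X := by
    intro i
    have h1 : star L * vec c (ρ₁ (EuclideanSpace.single i 1)) = η i • (c i * star L) := by
      have h2 : c i * star L = η i • (star L * vec c (ρ₁ (EuclideanSpace.single i 1))) := by
        calc c i * star L = star L * (L * c i) * star L := by
              rw [← mul_assoc, hLF.star_mul_self, one_mul]
          _ = _ := by
              rw [hL]
              simp only [mul_smul_comm, smul_mul_assoc, mul_assoc, hLF.mul_star_self, mul_one]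
      rw [h2, smul_smul, hη, one_smul]
    have h3 : star L * D (ρ₂ (EuclideanSpace.single i 1)) =
        D (ρ₂ (EuclideanSpace.single i 1)) * star L :=
      (hLS.star hW).comm_of_anti (hTD _).2.1
    rw [hX, mul_assoc, hR, mul_smul_comm, mul_assoc, ← mul_assoc K, (hTD _).2.2, hT, vec_smul]
    simp only [add_mul, mul_add, smul_mul_assoc, mul_smul_comm, ← mul_assoc, h1, h3, hd, hs]
    module
  have hv : ∀ i, s i • c i + d i = X * c i * star X := fun i => by
    rw [hXc, mul_assoc, hXF.mul_star_self, mul_one]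
  have hsq : ∀ i, (s i • c i + d i) * (s i • c i + d i) = 1 := by
    intro i
    rw [hv]
    calc X * c i * star X * (X * c i * star X) = X * (c i * (star X * X) * c i) * star X := by
          simp only [mul_assoc]
      _ = 1 := by rw [hXF.star_mul_self, mul_one, hc.sq, mul_one, hXF.mul_star_self]
  have hdd : ∀ i j, i ≠ j → d i * d j = -(d j * d i) := by
    intro i j hij
    have h1 : (s i • c i + d i) * (s j • c j + d j) = -((s j • c j + d j) * (s i • c i + d i)) := by
      have h2 : ∀ i j, X * c i * star X * (X * c j * star X) = X * (c i * c j) * star X := by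
        intro i j
        calc X * c i * star X * (X * c j * star X) = X * (c i * (star X * X) * c j) * star X := by
              simp only [mul_assoc]
          _ = _ := by rw [hXF.star_mul_self, mul_one]
      rw [hv, hv, h2, h2, hc.anti i j hij, mul_neg, neg_mul]
    simp only [add_mul, mul_add, smul_mul_smul_comm, smul_mul_assoc, mul_smul_comm, hdc,
      hc.anti i j hij] at h1
    rw [eq_neg_iff_add_eq_zero] at h1 ⊢
    rw [← h1]
    module
  choose p q G hp hq hpq hGF hG1 hG2 hEF hE hEe using
    fun i => hc.exists_half_rotation hW i (hdW i) (hdc i) (hsq i)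
  set E : Fin 4 → A := fun i => p i • (1 : A) + q i • G i with hEdef
  change ∀ i, IsFree W (E i) at hEF
  change ∀ i, E i * c i = _ * E i at hE
  have hEc : ∀ i j, i ≠ j → E i * c j = c j * E i := fun i j hij => by
    simp [hEdef, add_mul, mul_add, hG1 i j hij.symm]
  -- only `s 0` can be negative, so `E 0` is the only factor that may fail to commute with `d j`;
  -- as the rightmost factor of the product it only meets block vectors
  have hEd : ∀ i j, i ≠ 0 → i ≠ j → E i * d j = d j * E i := by
    intro i j hi hij
    refine hEe i ?_ _ (hdd i j hij) (hdc j)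
    have : 0 ≤ s i := by
      simp only [hs]
      rw [hη1 i hi, hθ1 i hi, one_mul, one_mul]
      exact hσ i
    linarith
  have hEv : ∀ i j, i ≠ 0 → i ≠ j → E i * (s j • c j + d j) = (s j • c j + d j) * E i := by
    intro i j hi hij
    simp only [mul_add, add_mul, mul_smul_comm, smul_mul_assoc, hEc i j hij, hEd i j hi hij]
  have hprodF : IsFree W (E 1 * E 2 * E 3 * E 0) :=
    (((hEF 1).mul (hEF 2)).mul (hEF 3)).mul (hEF 0)
  -- the product of the rotations acts on the block as `X` does
  have hprod : ∀ i, (E 1 * E 2 * E 3 * E 0) * c i =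
      (s i • c i + d i) * (E 1 * E 2 * E 3 * E 0) := by
    intro i
    fin_cases i
    · change E 1 * E 2 * E 3 * E 0 * c 0 = (s 0 • c 0 + d 0) * (E 1 * E 2 * E 3 * E 0)
      rw [mul_assoc, hE, ← mul_assoc, mul_assoc (E 1 * E 2), hEv 3 0 (by decide) (by decide),
        ← mul_assoc, mul_assoc (E 1), hEv 2 0 (by decide) (by decide), ← mul_assoc,
        hEv 1 0 (by decide) (by decide)]
      simp only [mul_assoc]
    · change E 1 * E 2 * E 3 * E 0 * c 1 = (s 1 • c 1 + d 1) * (E 1 * E 2 * E 3 * E 0)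
      rw [mul_assoc, hEc 0 1 (by decide), ← mul_assoc, mul_assoc (E 1 * E 2),
        hEc 3 1 (by decide), ← mul_assoc, mul_assoc (E 1), hEc 2 1 (by decide), ← mul_assoc, hE]
      simp only [mul_assoc]
    · change E 1 * E 2 * E 3 * E 0 * c 2 = (s 2 • c 2 + d 2) * (E 1 * E 2 * E 3 * E 0)
      rw [mul_assoc, hEc 0 2 (by decide), ← mul_assoc, mul_assoc (E 1 * E 2),
        hEc 3 2 (by decide), ← mul_assoc, mul_assoc (E 1), hE, ← mul_assoc,
        hEv 1 2 (by decide) (by decide)]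
      simp only [mul_assoc]
    · change E 1 * E 2 * E 3 * E 0 * c 3 = (s 3 • c 3 + d 3) * (E 1 * E 2 * E 3 * E 0)
      rw [mul_assoc, hEc 0 3 (by decide), ← mul_assoc, mul_assoc (E 1 * E 2), hE, ← mul_assoc,
        mul_assoc (E 1), hEv 2 3 (by decide) (by decide), ← mul_assoc,
        hEv 1 3 (by decide) (by decide)]
      simp only [mul_assoc]
  set P := E 1 * E 2 * E 3 * E 0 with hP
  refine ⟨L, R, star P * X, p, q, G, hLS, hRS, hRF, hprodF.star.mul hXF,
    fun i => ⟨hp i, hq i, hpq i⟩, hGF, hG1, hG2, fun k => ?_, ?_⟩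
  · have hcs : c k * star P = star P * (s k • c k + d k) := by
      calc c k * star P = star P * (P * c k) * star P := by
            rw [← mul_assoc, hprodF.star_mul_self, one_mul]
        _ = star P * (s k • c k + d k) := by
            rw [hprod, ← mul_assoc, mul_assoc, hprodF.mul_star_self, mul_one]
    rw [← mul_assoc, hcs, mul_assoc (star P) _ X, ← hXc, mul_assoc (star P) X]
  · change K = L * P * (star P * X) * star R
    calc K = (L * star L) * K * (R * star R) := by
          rw [hLF.mul_star_self, hRF.mul_star_self, one_mul, mul_one]
      _ = L * (P * star P) * (star L * K * R) * star R := by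
          rw [hprodF.mul_star_self]
          simp only [mul_assoc, one_mul]
      _ = _ := by simp only [mul_assoc, hX]

end NormalForm

section TraceBound

/-! ### The trace bound for one block -/

variable {A : Type*} [Ring A] [StarRing A] [Algebra ℝ A] [StarModule ℝ A]
variable {W : Submodule ℝ A} {K L : A} {c : Fin 4 → A} {τ : A →ₗ[ℝ] ℂ}

/-- The squares of the four pairs of complementary even weights sum to at most one. -/
theorem sum_sq_weights_le_one {p q : Fin 4 → ℝ}
    (h : ∀ i, 0 ≤ p i ∧ 0 ≤ q i ∧ p i ^ 2 + q i ^ 2 = 1) :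
    (p 0 * p 1 * p 2 * p 3 + q 0 * q 1 * q 2 * q 3) ^ 2 +
      (q 0 * q 1 * p 2 * p 3 + p 0 * p 1 * q 2 * q 3) ^ 2 +
      (q 0 * p 1 * q 2 * p 3 + p 0 * q 1 * p 2 * q 3) ^ 2 +
      (p 0 * q 1 * q 2 * p 3 + q 0 * p 1 * p 2 * q 3) ^ 2 ≤ 1 := by
  -- for the pairs of indices `0, 1` and `2, 3`, the sum is `A B + (1 - A) (1 - B) + 2 a b`
  have key : ∀ i j, ∃ A a : ℝ, 0 ≤ a ∧ a ≤ A ∧ a ≤ 1 - A ∧ a = 2 * (p i * q i * p j * q j) ∧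
      A = (p i * p j) ^ 2 + (q i * q j) ^ 2 ∧ 1 - A = (q i * p j) ^ 2 + (p i * q j) ^ 2 := by
    intro i j
    obtain ⟨hpi, hqi, hi⟩ := h i
    obtain ⟨hpj, hqj, hj⟩ := h j
    have hA : 1 - ((p i * p j) ^ 2 + (q i * q j) ^ 2) = (q i * p j) ^ 2 + (p i * q j) ^ 2 := by
      linear_combination (-(p j ^ 2 + q j ^ 2)) * hi - hj
    refine ⟨_, _, by positivity, ?_, ?_, rfl, rfl, hA⟩
    · nlinarith [sq_nonneg (p i * p j - q i * q j)]
    · rw [hA]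
      nlinarith [sq_nonneg (q i * p j - p i * q j)]
  obtain ⟨A, a, ha0, haA, haA', hae, hAe, hAe'⟩ := key 0 1
  obtain ⟨B, b, hb0, hbB, hbB', hbe, hBe, hBe'⟩ := key 2 3
  have h1 : a * b ≤ A * (1 - B) := mul_le_mul haA hbB' hb0 (ha0.trans haA)
  have h2 : a * b ≤ (1 - A) * B := mul_le_mul haA' hbB hb0 (ha0.trans haA')
  have h3 : (p 0 * p 1 * p 2 * p 3 + q 0 * q 1 * q 2 * q 3) ^ 2 +
      (q 0 * q 1 * p 2 * p 3 + p 0 * p 1 * q 2 * q 3) ^ 2 +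
      (q 0 * p 1 * q 2 * p 3 + p 0 * q 1 * p 2 * q 3) ^ 2 +
      (p 0 * q 1 * q 2 * p 3 + q 0 * p 1 * p 2 * q 3) ^ 2 =
      A * B + (1 - A) * (1 - B) + 2 * (a * b) := by
    rw [hAe', hBe', hAe, hBe, hae, hbe]
    ring
  rw [h3]
  linarith

/-- Operators that anticommute with a vector of the block have no trace against operators that
commute with it. -/
theorem trace_eq_zero_of_anti (hτ : ∀ x y, τ (x * y) = τ (y * x)) {e X Z : A} (he : e * e = 1)
    (hX : e * X = -(X * e)) (hZ : e * Z = Z * e) : τ (X * Z) = 0 := by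
  have h : τ (X * Z) = -τ (X * Z) := by
    calc τ (X * Z) = τ (X * Z * e * e) := by rw [mul_assoc, he, mul_one]
      _ = τ (e * X * Z * e) := by rw [hτ, ← mul_assoc, ← mul_assoc]
      _ = -τ (X * Z) := by
        rw [hX, neg_mul, neg_mul, map_neg, mul_assoc X, hZ, mul_assoc, mul_assoc, he, mul_one]
  exact self_eq_neg.1 h

/-- Against an operator that commutes with the block vector `e`, only one of the two terms of a
half-angle rotation has a trace. -/
theorem trace_half_rotation (hτ : ∀ x y, τ (x * y) = τ (y * x)) {e X G B Z : A} {p q : ℝ}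
    (S : Bool) (he : e * e = 1) (hX : e * X = bif S then -(X * e) else X * e)
    (hG : e * G = -(G * e)) (hB : e * B = B * e) (hZ : e * Z = Z * e) :
    τ (X * (p • 1 + q • G) * B * Z) = τ (X * (bif S then q • G else p • 1) * B * Z) := by
  cases S
  · simp only [cond_false] at hX ⊢
    rw [mul_add, add_mul, add_mul, map_add, add_eq_left]
    refine trace_eq_zero_of_anti hτ he ?_ hZ
    simp only [mul_smul_comm, smul_mul_assoc, ← mul_assoc, hX]
    rw [mul_assoc X, hG, mul_neg, neg_mul, ← mul_assoc, mul_assoc _ e B, hB,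
      ← mul_assoc, smul_neg]
  · simp only [cond_true] at hX ⊢
    rw [mul_add, add_mul, add_mul, map_add, add_eq_right]
    refine trace_eq_zero_of_anti hτ he ?_ hZ
    simp only [mul_smul_comm, smul_mul_assoc, ← mul_assoc, hX, mul_one]
    rw [neg_mul, mul_assoc, hB, mul_assoc, smul_neg]

/-- The contribution of a single monomial `g` of the block: `S` is the set of block vectors that
anticommute with `g`. -/
theorem IsBlock.norm_trace_monomial_le (hc : IsBlock W c)
    (hτ : ∀ x y, τ (x * y) = τ (y * x)) {Z : A} {C : ℝ}
    (hZ : ∀ K, IsFree W K → ‖τ (K * Z)‖ ≤ C) (hZc : ∀ k, c k * Z = Z * c k)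
    {p q : Fin 4 → ℝ} {G : Fin 4 → A} (h : ∀ i, 0 ≤ p i ∧ 0 ≤ q i ∧ p i ^ 2 + q i ^ 2 = 1)
    (hGF : ∀ i, IsFree W (G i)) (hG1 : ∀ i k, k ≠ i → c k * G i = G i * c k)
    (hG2 : ∀ i, c i * G i = -(G i * c i)) {g : A} (hg : IsFree W g) (S : Fin 4 → Bool)
    (hgS : ∀ k, c k * g = bif S k then -(g * c k) else g * c k) :
    ‖τ (g * ((p 1 • 1 + q 1 • G 1) * (p 2 • 1 + q 2 • G 2) * (p 3 • 1 + q 3 • G 3) *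
        (p 0 • 1 + q 0 • G 0)) * Z)‖ ≤
      (bif S 0 then q 0 else p 0) * (bif S 1 then q 1 else p 1) * (bif S 2 then q 2 else p 2) *
        (bif S 3 then q 3 else p 3) * C := by
  set E : Fin 4 → A := fun i => p i • (1 : A) + q i • G i with hE
  -- `e i` is the term of `E i` that `g` selects, `r i` its coefficient, `H i` its free unitary
  set e : Fin 4 → A := fun i => bif S i then q i • G i else p i • 1 with he
  set r : Fin 4 → ℝ := fun i => bif S i then q i else p i with hr
  set H : Fin 4 → A := fun i => bif S i then G i else 1 with hH
  have hr0 : ∀ i, 0 ≤ r i := by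
    intro i
    simp only [hr]
    cases S i
    exacts [(h i).1, (h i).2.1]
  have hHF : ∀ i, IsFree W (H i) := by
    intro i
    simp only [hH]
    cases S i
    exacts [IsFree.one, hGF i]
  have heH : ∀ i, e i = r i • H i := by
    intro i
    simp only [he, hH, hr]
    cases S i <;> rfl
  have hEc : ∀ i k, k ≠ i → c k * E i = E i * c k := by
    intro i k hk
    simp [hE, mul_add, add_mul, hG1 i k hk]
  have hec : ∀ i k, k ≠ i → c k * e i = e i * c k := by
    intro i k hk
    simp only [he]
    cases S i <;> simp [hG1 i k hk]
  have hXe : ∀ X i k, k ≠ i → (c k * X = bif S k then -(X * c k) else X * c k) →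
      c k * (X * e i) = bif S k then -(X * e i * c k) else X * e i * c k := by
    intro X i k hk hX
    rw [← mul_assoc, hX]
    cases S k <;> simp [mul_assoc, hec i k hk]
  have hBE : ∀ B i k, k ≠ i → c k * B = B * c k → c k * (E i * B) = E i * B * c k := by
    intro B i k hk hB
    rw [← mul_assoc, hEc i k hk, mul_assoc, hB, mul_assoc]
  have h1 : ∀ k X B, (c k * X = bif S k then -(X * c k) else X * c k) → c k * B = B * c k →
      τ (X * E k * B * Z) = τ (X * e k * B * Z) := fun k X B hX hB =>
    trace_half_rotation hτ (S k) (hc.sq k) hX (hG2 k) hB (hZc k)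
  have hstep : τ (g * (E 1 * E 2 * E 3 * E 0) * Z) = τ (g * e 1 * e 2 * e 3 * e 0 * Z) := by
    calc τ (g * (E 1 * E 2 * E 3 * E 0) * Z) = τ (g * E 1 * (E 2 * (E 3 * E 0)) * Z) := by
          simp only [mul_assoc]
      _ = τ (g * e 1 * E 2 * (E 3 * E 0) * Z) := by
          rw [h1 1 g _ (hgS 1) (hBE _ _ _ (by decide) (hBE _ _ _ (by decide)
            (hEc _ _ (by decide))))]
          simp only [mul_assoc]
      _ = τ (g * e 1 * e 2 * E 3 * E 0 * Z) := by
          rw [h1 2 (g * e 1) _ (hXe _ _ _ (by decide) (hgS 2)) (hBE _ _ _ (by decide)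
            (hEc _ _ (by decide)))]
          simp only [mul_assoc]
      _ = τ (g * e 1 * e 2 * e 3 * E 0 * 1 * Z) := by
          rw [h1 3 (g * e 1 * e 2) _ (hXe _ _ _ (by decide) (hXe _ _ _ (by decide) (hgS 3)))
            (hEc _ _ (by decide)), mul_one]
      _ = τ (g * e 1 * e 2 * e 3 * e 0 * Z) := by
          rw [h1 0 (g * e 1 * e 2 * e 3) _ (hXe _ _ _ (by decide) (hXe _ _ _ (by decide)
            (hXe _ _ _ (by decide) (hgS 0)))) (by simp), mul_one]
  change ‖τ (g * (E 1 * E 2 * E 3 * E 0) * Z)‖ ≤ r 0 * r 1 * r 2 * r 3 * C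
  have hfac : g * e 1 * e 2 * e 3 * e 0 * Z =
      (r 0 * r 1 * r 2 * r 3) • (g * H 1 * H 2 * H 3 * H 0 * Z) := by
    simp only [heH, mul_smul_comm, smul_mul_assoc, smul_smul]
    congr 1
    ring
  rw [hstep, hfac, map_smul, norm_smul, Real.norm_eq_abs, abs_of_nonneg
    (mul_nonneg (mul_nonneg (mul_nonneg (hr0 0) (hr0 1)) (hr0 2)) (hr0 3))]
  exact mul_le_mul_of_nonneg_left (hZ _ ((((hg.mul (hHF 1)).mul (hHF 2)).mul (hHF 3)).mul (hHF 0)))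
    (mul_nonneg (mul_nonneg (mul_nonneg (hr0 0) (hr0 1)) (hr0 2)) (hr0 3))

open scoped Quaternion in
/-- Multiplying by `1 + i ε Γ`, where `Γ` is the parity of a block, preserves the property of having
absolute trace at most `C` against every free unitary. The central element `J` is the imaginary unit
of the algebra, which is regarded as a real algebra here. -/
theorem IsBlock.norm_trace_le [Nontrivial A] (hc : IsBlock W c) (hW : IsMajoranaSpace W)
    (hτ : ∀ x y, τ (x * y) = τ (y * x)) {J : A} (hJ : ∀ x, J * x = x * J)
    (hτJ : ∀ x, τ (J * x) = Complex.I * τ x) {M : A} {C : ℝ} (hC : 0 ≤ C)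
    (hM : ∀ K, IsFree W K → ‖τ (K * M)‖ ≤ C) (hMc : ∀ k, c k * M = M * c k)
    {ε : ℝ} (hε : ε ^ 2 = 1) (hK : IsFree W K) :
    ‖τ (K * (M * (1 + ε • (J * blockParity c))))‖ ≤ C := by
  obtain ⟨L, R, Y, p, q, G, hL, hR, hRF, hY, h, hGF, hG1, hG2, hYc, hKeq⟩ :=
    hc.exists_normalForm hW hK
  set P := (p 1 • 1 + q 1 • G 1) * (p 2 • 1 + q 2 • G 2) * (p 3 • 1 + q 3 • G 3) *
        (p 0 • 1 + q 0 • G 0) with hP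
  set Γ := blockParity c with hΓ
  have hRs := hR.star hW
  have hRΓ : star R * Γ = Γ * star R := by
    obtain ⟨x, y, -, -, hxy⟩ := hRs
    rw [hxy, add_mul, mul_add, hc.quat_comm, mul_assoc, hc.quat_comm]
  have hRM : star R * M = M * star R := hRs.comm_of_comm hMc
  set Z := Y * M with hZdef
  have hZ : ∀ K, IsFree W K → ‖τ (K * Z)‖ ≤ C := fun K hK => by
    rw [hZdef, ← mul_assoc]
    exact hM _ (hK.mul hY)
  have hZc : ∀ k, c k * Z = Z * c k := fun k => by
    rw [hZdef, ← mul_assoc, hYc, mul_assoc, hMc, mul_assoc]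
  obtain ⟨x, y, hx, hy, hxy⟩ := hRs.mul hL
  -- the trace is brought to the form `(1 + i ε Γ) (R* L) P Z`
  have htr : τ (K * (M * (1 + ε • (J * Γ)))) =
      τ ((1 + ε • (J * Γ)) * (hc.quat x + Γ * hc.quat y) * P * Z) := by
    have hN : star R * (1 + ε • (J * Γ)) = (1 + ε • (J * Γ)) * star R := by
      rw [mul_add, add_mul, mul_smul_comm, smul_mul_assoc, ← mul_assoc, ← hJ, mul_assoc, hRΓ,
        mul_assoc, one_mul, mul_one]
    calc τ (K * (M * (1 + ε • (J * Γ)))) = τ (L * P * Y * (star R * M) * (1 + ε • (J * Γ))) := by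
          rw [hKeq]; simp only [mul_assoc]
      _ = τ (L * P * (Y * M) * (star R * (1 + ε • (J * Γ)))) := by
          rw [hRM]; simp only [mul_assoc]
      _ = τ ((1 + ε • (J * Γ)) * (star R * L) * P * Z) := by
          rw [hτ, hN]; simp only [mul_assoc, hZdef]
      _ = _ := by rw [hxy]
  have hc0 := hW.isFree (hc.mem 0) (hc.sq 0)
  have hc1 := hW.isFree (hc.mem 1) (hc.sq 1)
  have hc2 := hW.isFree (hc.mem 2) (hc.sq 2)
  have hc3 := hW.isFree (hc.mem 3) (hc.sq 3)
  have hΓF : IsFree W Γ := ((hc0.mul hc1).mul hc2).mul hc3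
  set φ : A → ℂ := fun X => τ (X * P * Z) with hφ
  have hmono : ∀ (g : A), IsFree W g → ∀ (S : Fin 4 → Bool),
      (∀ k, c k * g = bif S k then -(g * c k) else g * c k) →
      ‖φ g‖ ≤ (bif S 0 then q 0 else p 0) * (bif S 1 then q 1 else p 1) *
        (bif S 2 then q 2 else p 2) * (bif S 3 then q 3 else p 3) * C := fun g hg S hgS => by
    have := hc.norm_trace_monomial_le hτ hZ hZc h hGF hG1 hG2 hg S hgS
    rwa [← hP] at this
  -- the four quaternion units and their products with the parity
  set g : Fin 4 → A := ![1, c 0 * c 1, c 0 * c 2, c 0 * c 1 * (c 0 * c 2)] with hg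
  set X : Fin 4 → ℝ := ![x.re, x.imI, x.imJ, x.imK] with hXdef
  set Y' : Fin 4 → ℝ := ![y.re, y.imI, y.imJ, y.imK] with hYdef
  set w : Fin 4 → ℝ := ![p 0 * p 1 * p 2 * p 3 + q 0 * q 1 * q 2 * q 3,
    q 0 * q 1 * p 2 * p 3 + p 0 * p 1 * q 2 * q 3, q 0 * p 1 * q 2 * p 3 + p 0 * q 1 * p 2 * q 3,
    p 0 * q 1 * q 2 * p 3 + q 0 * p 1 * p 2 * q 3] with hw
  have hgw : ∀ a, ‖φ (g a)‖ + ‖φ (Γ * g a)‖ ≤ w a * C := by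
    obtain ⟨⟨h10, h20, h30, h21, h31, h32⟩, k10, k20, k30, k21, k31, k32, kk⟩ := hc.normal_order
    have hS : ∀ (b : A) (S : Fin 4 → Bool),
        (∀ k, c k * b = bif S k then -(b * c k) else b * c k) →
        ∀ k, c k * (Γ * b) = bif !(S k) then -(Γ * b * c k) else Γ * b * c k := by
      intro b S hb k
      rw [← mul_assoc, hc.blockParity_anti, neg_mul, mul_assoc, hb]
      cases S k <;> simp [mul_assoc, hΓ]
    have hpair : ∀ (b : A), IsFree W b → ∀ (S : Fin 4 → Bool),
        (∀ k, c k * b = bif S k then -(b * c k) else b * c k) → ‖φ b‖ + ‖φ (Γ * b)‖ ≤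
        ((bif S 0 then q 0 else p 0) * (bif S 1 then q 1 else p 1) *
        (bif S 2 then q 2 else p 2) * (bif S 3 then q 3 else p 3) +
        (bif !(S 0) then q 0 else p 0) * (bif !(S 1) then q 1 else p 1) *
        (bif !(S 2) then q 2 else p 2) * (bif !(S 3) then q 3 else p 3)) * C := by
      intro b hb S hbS
      rw [add_mul]
      exact add_le_add (hmono b hb S hbS) (hmono _ (hΓF.mul hb) (fun k => !(S k)) (hS b S hbS))
    intro a
    fin_cases a
    · have := hpair 1 IsFree.one ![false, false, false, false] (by
        intro k; fin_cases k <;> simp)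
      simpa [hg, hw] using this
    · have := hpair (c 0 * c 1) (hc0.mul hc1) ![true, true, false, false] (by
        intro k; fin_cases k <;>
        simp [mul_assoc, k10, k20, k30, k21, k31, k32, kk, hc.sq, h10, h20, h30, h21, h31, h32])
      simpa [hg, hw] using this
    · have := hpair (c 0 * c 2) (hc0.mul hc2) ![true, false, true, false] (by
        intro k; fin_cases k <;>
        simp [mul_assoc, k10, k20, k30, k21, k31, k32, kk, hc.sq, h10, h20, h30, h21, h31, h32])
      simpa [hg, hw] using this
    · have := hpair (c 0 * c 1 * (c 0 * c 2)) ((hc0.mul hc1).mul (hc0.mul hc2))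
        ![false, true, true, false] (by
        intro k; fin_cases k <;>
        simp [mul_assoc, k10, k20, k30, k21, k31, k32, kk, hc.sq, h10, h20, h30, h21, h31, h32])
      simpa [hg, hw] using this
  have hquat : ∀ z : ℍ[ℝ], hc.quat z = ∑ a, ![z.re, z.imI, z.imJ, z.imK] a • g a := fun z => by
    rw [hc.quat_apply]
    simp [Fin.sum_univ_four, hg]
  have hφadd : ∀ a b, φ (a + b) = φ a + φ b := fun a b => by simp [hφ, add_mul]
  have hφsmul : ∀ (r : ℝ) a, φ (r • a) = r * φ a := fun r a => by simp [hφ]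
  have hφJ : ∀ a, φ (J * a) = Complex.I * φ a := fun a => by simp [hφ, mul_assoc, hτJ]
  have hφsum : ∀ (s : Fin 4 → A), φ (∑ a, s a) = ∑ a, φ (s a) := fun s => by
    simp [hφ, Finset.sum_mul]
  have hexp : φ ((1 + ε • (J * Γ)) * (hc.quat x + Γ * hc.quat y)) =
      ∑ a, ((X a + ε * Complex.I * Y' a) * φ (g a) +
        (Y' a + ε * Complex.I * X a) * φ (Γ * g a)) := by
    have hΓΓ : Γ * Γ = 1 := hc.blockParity_mul_self
    have : (1 + ε • (J * Γ)) * (hc.quat x + Γ * hc.quat y) =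
        hc.quat x + Γ * hc.quat y + ε • (J * (Γ * hc.quat x)) + ε • (J * hc.quat y) := by
      rw [add_mul, one_mul, mul_add (ε • (J * Γ)), smul_mul_assoc, smul_mul_assoc, mul_assoc J Γ,
        mul_assoc J Γ, ← mul_assoc Γ Γ, hΓΓ, one_mul]
      abel
    rw [this, hφadd, hφadd, hφadd, hφsmul, hφsmul, hφJ, hφJ, hquat, hquat]
    simp only [Finset.mul_sum Finset.univ _ Γ, mul_smul_comm, hφsum, hφsmul]
    simp only [Finset.mul_sum, ← Finset.sum_add_distrib]
    refine Finset.sum_congr rfl fun a _ => ?_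
    simp only [hXdef, hYdef]
    ring
  have hnorm : ∀ a b : ℝ, ‖(a + ε * Complex.I * b : ℂ)‖ = √(a ^ 2 + b ^ 2) := by
    intro a b
    rw [show (a + ε * Complex.I * b : ℂ) = a + (ε * b : ℝ) * Complex.I by push_cast; ring,
      Complex.norm_add_mul_I, mul_pow, hε, one_mul]
  -- the parallelogram identity for the unit quaternions `x + y` and `x - y`
  have hXY : ∑ a, √(X a ^ 2 + Y' a ^ 2) ^ 2 = 1 := by
    have e1 : Quaternion.normSq (x + y) = 1 := by
      rw [Quaternion.normSq_eq_norm_mul_self, hx, one_mul]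
    have e2 : Quaternion.normSq (x - y) = 1 := by
      rw [Quaternion.normSq_eq_norm_mul_self, hy, one_mul]
    rw [Quaternion.normSq_def'] at e1 e2
    simp only [Quaternion.re_add, Quaternion.imI_add, Quaternion.imJ_add, Quaternion.imK_add,
      Quaternion.re_sub, Quaternion.imI_sub, Quaternion.imJ_sub, Quaternion.imK_sub] at e1 e2
    have : ∀ a, √(X a ^ 2 + Y' a ^ 2) ^ 2 = X a ^ 2 + Y' a ^ 2 := fun a =>
      Real.sq_sqrt (by positivity)
    rw [Finset.sum_congr rfl fun a _ => this a]
    simp only [Fin.sum_univ_four, hXdef, hYdef]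
    simp
    linarith
  have hwsq : ∑ a, w a ^ 2 ≤ 1 := by
    have := sum_sq_weights_le_one h
    simpa [Fin.sum_univ_four, hw] using this
  -- the Cauchy-Schwarz inequality for the spin coefficients against the weights
  have hcs : ∑ a, √(X a ^ 2 + Y' a ^ 2) * w a ≤ 1 := by
    have := Finset.sum_mul_sq_le_sq_mul_sq Finset.univ (fun a => √(X a ^ 2 + Y' a ^ 2)) w
    rw [hXY, one_mul] at this
    exact (abs_le_one_iff_mul_self_le_one.2 (by rw [← pow_two]; exact this.trans hwsq)).trans'
      (le_abs_self _)
  rw [htr]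
  change ‖φ ((1 + ε • (J * Γ)) * (hc.quat x + Γ * hc.quat y))‖ ≤ C
  rw [hexp]
  calc _ ≤ ∑ a, ‖(X a + ε * Complex.I * Y' a) * φ (g a) +
        (Y' a + ε * Complex.I * X a) * φ (Γ * g a)‖ := norm_sum_le _ _
    _ ≤ ∑ a, √(X a ^ 2 + Y' a ^ 2) * w a * C := by
        refine Finset.sum_le_sum fun a _ => (norm_add_le _ _).trans ?_
        rw [norm_mul, norm_mul, hnorm, hnorm, add_comm (Y' a ^ 2), ← mul_add, mul_assoc]
        exact mul_le_mul_of_nonneg_left (hgw a) (Real.sqrt_nonneg _)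
    _ = (∑ a, √(X a ^ 2 + Y' a ^ 2) * w a) * C := by rw [Finset.sum_mul]
    _ ≤ 1 * C := mul_le_mul_of_nonneg_right hcs hC
    _ = C := one_mul C

end TraceBound

section LocalOperators

/-! ### One- and two-qubit operators inside `n` qubits -/

variable {n : ℕ}

theorem onQubit_mul_apply (j : Fin n) (A : OneQubitOp) (M : QubitOp n) (x y : Fin n → Fin 2) :
    (onQubit j A * M) x y = ∑ b, A (x j) b * M (Function.update x j b) y := by
  rw [Matrix.mul_apply]
  refine (Fintype.sum_of_injective (fun b => Function.update x j b)
    (Function.update_injective x j) _ _ ?_ ?_).symm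
  · intro z hz
    rw [onQubit, if_neg, zero_mul]
    intro h
    refine hz ⟨z j, ?_⟩
    ext l
    by_cases hl : l = j
    · subst hl; simp
    · simp [hl, h l hl]
  · intro b
    simp only [onQubit]
    rw [if_pos]
    · simp
    · intro l hl
      simp [hl]

theorem onQubit_conjTranspose (j : Fin n) (A : OneQubitOp) :
    (onQubit j A)ᴴ = onQubit j Aᴴ := by
  ext x y
  simp only [Matrix.conjTranspose_apply, onQubit, eq_comm (a := y _)]
  split_ifs <;> simp

theorem mul_onQubit_apply (j : Fin n) (A : OneQubitOp) (M : QubitOp n) (x y : Fin n → Fin 2) :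
    (M * onQubit j A) x y = ∑ b, M x (Function.update y j b) * A b (y j) := by
  have h : (M * onQubit j A) = (onQubit j Aᴴ * Mᴴ)ᴴ := by
    rw [Matrix.conjTranspose_mul, onQubit_conjTranspose, Matrix.conjTranspose_conjTranspose,
      Matrix.conjTranspose_conjTranspose]
  rw [h, Matrix.conjTranspose_apply, onQubit_mul_apply]
  simp [mul_comm]

theorem onQubit_mul (j : Fin n) (A B : OneQubitOp) :
    onQubit j A * onQubit j B = onQubit j (A * B) := by
  ext x y
  rw [onQubit_mul_apply]
  have : ∀ b, (∀ l, l ≠ j → Function.update x j b l = y l) ↔ ∀ l, l ≠ j → x l = y l := fun b =>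
    forall₂_congr fun l hl => by simp [hl]
  simp only [onQubit, this, Function.update_self, Matrix.mul_apply]
  split_ifs <;> simp

theorem onQubit_one (j : Fin n) : onQubit j (1 : OneQubitOp) = 1 := by
  ext x y
  simp only [onQubit, Matrix.one_apply]
  by_cases h : x = y
  · simp [h]
  · rw [if_neg h]
    split_ifs with h1 h2
    · exact absurd (funext fun l => by
        by_cases hl : l = j
        · rw [hl, h2]
        · exact h1 l hl) h
    · rfl
    · rfl

theorem onQubit_smul (j : Fin n) (r : ℂ) (A : OneQubitOp) :
    onQubit j (r • A) = r • onQubit j A := by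
  ext x y
  simp only [onQubit, Matrix.smul_apply]
  split_ifs <;> simp

theorem onPair_mul_apply {j k : Fin n} (hjk : j ≠ k) (A : TwoQubitOp) (M : QubitOp n)
    (x y : Fin n → Fin 2) :
    (onPair j k A * M) x y = ∑ b : Fin 2 × Fin 2, A (x j, x k) b *
      M (Function.update (Function.update x j b.1) k b.2) y := by
  rw [Matrix.mul_apply]
  refine (Fintype.sum_of_injective
    (fun b : Fin 2 × Fin 2 => Function.update (Function.update x j b.1) k b.2) ?_ _ _ ?_ ?_).symm
  · intro b b' h
    have h1 := congrFun h j
    have h2 := congrFun h k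
    simp [hjk] at h1 h2
    exact Prod.ext h1 h2
  · intro z hz
    rw [onPair, if_neg, zero_mul]
    intro h
    refine hz ⟨(z j, z k), ?_⟩
    ext l
    by_cases hk : l = k
    · subst hk; simp
    · by_cases hl : l = j
      · subst hl; simp [hk]
      · simp [hl, hk, h l hl hk]
  · intro b
    simp only [onPair]
    rw [if_pos]
    · simp [hjk]
    · intro l hl hk
      simp [hl, hk]

theorem onPair_conjTranspose (j k : Fin n) (A : TwoQubitOp) :
    (onPair j k A)ᴴ = onPair j k Aᴴ := by
  ext x y
  simp only [Matrix.conjTranspose_apply, onPair, eq_comm (a := y _)]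
  split_ifs <;> simp

theorem onPair_mul {j k : Fin n} (hjk : j ≠ k) (A B : TwoQubitOp) :
    onPair j k A * onPair j k B = onPair j k (A * B) := by
  ext x y
  rw [onPair_mul_apply hjk]
  have : ∀ b : Fin 2 × Fin 2, (∀ l, l ≠ j → l ≠ k →
      Function.update (Function.update x j b.1) k b.2 l = y l) ↔
      ∀ l, l ≠ j → l ≠ k → x l = y l := fun b =>
    forall₃_congr fun l hl hk => by simp [hl, hk]
  simp only [onPair, this, Function.update_self, Matrix.mul_apply]
  split_ifs <;> simp [hjk]

theorem onPair_one {j k : Fin n} : onPair j k (1 : TwoQubitOp) = 1 := by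
  ext x y
  simp only [onPair, Matrix.one_apply]
  by_cases h : x = y
  · simp [h]
  · rw [if_neg h]
    split_ifs with h1 h2
    · rw [Prod.mk.injEq] at h2
      exact absurd (funext fun l => by
        by_cases hl : l = j
        · rw [hl, h2.1]
        · by_cases hk : l = k
          · rw [hk, h2.2]
          · exact h1 l hl hk) h
    · rfl
    · rfl

theorem onPair_add (j k : Fin n) (A B : TwoQubitOp) :
    onPair j k (A + B) = onPair j k A + onPair j k B := by
  ext x y
  simp only [onPair, Matrix.add_apply]
  split_ifs <;> simp

theorem onPair_smul (j k : Fin n) (r : ℂ) (A : TwoQubitOp) :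
    onPair j k (r • A) = r • onPair j k A := by
  ext x y
  simp only [onPair, Matrix.smul_apply]
  split_ifs <;> simp

theorem onPair_kronecker {j k : Fin n} (hjk : j ≠ k) (A B : OneQubitOp) :
    onPair j k (A ⊗ₖ B) = onQubit j A * onQubit k B := by
  ext x y
  rw [onQubit_mul_apply]
  have : ∀ b, (∀ l, l ≠ k → Function.update x j b l = y l) ↔
      b = y j ∧ ∀ l, l ≠ j → l ≠ k → x l = y l := by
    intro b
    constructor
    · intro h
      refine ⟨by simpa using h j hjk, fun l hl hk => by simpa [hl] using h l hk⟩
    · rintro ⟨rfl, h⟩ l hk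
      by_cases hl : l = j
      · subst hl; simp
      · simp [hl, h l hl hk]
  simp only [onQubit, onPair, this, Matrix.kronecker_apply, ite_and]
  split_ifs with h
  · simp [h, hjk.symm]
  · simp [h]

theorem commute_onQubit_onPair {j k l : Fin n} (hj : l ≠ j) (hk : l ≠ k) (A : OneQubitOp)
    (M : TwoQubitOp) : Commute (onQubit l A) (onPair j k M) := by
  ext x y
  rw [onQubit_mul_apply, mul_onQubit_apply]
  have h1 : ∀ b, (∀ m, m ≠ j → m ≠ k → Function.update x l b m = y m) ↔
      b = y l ∧ ∀ m, m ≠ l → m ≠ j → m ≠ k → x m = y m := by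
    intro b
    constructor
    · intro h
      refine ⟨by simpa using h l hj hk, fun m hl h1 h2 => by simpa [hl] using h m h1 h2⟩
    · rintro ⟨rfl, h⟩ m h1 h2
      by_cases hl : m = l
      · subst hl; simp
      · simp [hl, h m hl h1 h2]
  have h2 : ∀ b, (∀ m, m ≠ j → m ≠ k → x m = Function.update y l b m) ↔
      b = x l ∧ ∀ m, m ≠ l → m ≠ j → m ≠ k → x m = y m := by
    intro b
    constructor
    · intro h
      refine ⟨by simpa using (h l hj hk).symm, fun m hl h1 h2 => by simpa [hl] using h m h1 h2⟩
    · rintro ⟨rfl, h⟩ m h1 h2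
      by_cases hl : m = l
      · subst hl; simp
      · simp [hl, h m hl h1 h2]
  simp only [onPair, h1, h2, ite_and]
  split_ifs with h
  · simp [h, hj.symm, hk.symm, mul_comm]
  · simp

theorem commute_onQubit_onQubit {j k : Fin n} (hjk : j ≠ k) (A B : OneQubitOp) :
    Commute (onQubit j A) (onQubit k B) := by
  ext x y
  rw [onQubit_mul_apply, mul_onQubit_apply]
  have h1 : ∀ b, (∀ m, m ≠ k → Function.update x j b m = y m) ↔
      b = y j ∧ ∀ m, m ≠ j → m ≠ k → x m = y m := by
    intro b
    constructor
    · intro h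
      refine ⟨by simpa using h j hjk, fun m hl h1 => by simpa [hl] using h m h1⟩
    · rintro ⟨rfl, h⟩ m h1
      by_cases hl : m = j
      · subst hl; simp
      · simp [hl, h m hl h1]
  have h2 : ∀ b, (∀ m, m ≠ k → x m = Function.update y j b m) ↔
      b = x j ∧ ∀ m, m ≠ j → m ≠ k → x m = y m := by
    intro b
    constructor
    · intro h
      refine ⟨by simpa using (h j hjk).symm, fun m hl h1 => by simpa [hl] using h m h1⟩
    · rintro ⟨rfl, h⟩ m h1
      by_cases hl : m = j
      · subst hl; simp
      · simp [hl, h m hl h1]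
  simp only [onQubit, h1, h2, ite_and]
  split_ifs with h
  · simp [h, hjk.symm, mul_comm]
  · simp

theorem commute_diagonal_of_support {m : Type*} [Fintype m] [DecidableEq m] {d : m → ℂ}
    {M : Matrix m m ℂ} (h : ∀ x y, M x y ≠ 0 → d x = d y) : Commute (Matrix.diagonal d) M := by
  ext x y
  rw [Matrix.diagonal_mul, Matrix.mul_diagonal]
  by_cases hM : M x y = 0
  · simp [hM]
  · rw [h x y hM, mul_comm]

theorem onQubit_support {j : Fin n} {A : OneQubitOp} {x y : Fin n → Fin 2}
    (h : onQubit j A x y ≠ 0) : (∀ l, l ≠ j → x l = y l) ∧ A (x j) (y j) ≠ 0 := by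
  unfold onQubit at h
  split_ifs at h with h1
  · exact ⟨h1, h⟩
  · exact absurd rfl h

theorem onPair_support {j k : Fin n} {A : TwoQubitOp} {x y : Fin n → Fin 2}
    (h : onPair j k A x y ≠ 0) :
    (∀ l, l ≠ j → l ≠ k → x l = y l) ∧ A (x j, x k) (y j, y k) ≠ 0 := by
  unfold onPair at h
  split_ifs at h with h1
  · exact ⟨h1, h⟩
  · exact absurd rfl h

/-! ### Majorana operators -/

/-- The eigenvalue of `Z` at a computational basis vector. -/
def zSign (b : Fin 2) : ℂ := if b = 0 then 1 else -1

theorem zSign_mul_self (b : Fin 2) : zSign b * zSign b = 1 := by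
  unfold zSign; split_ifs <;> simp

theorem pauliZ_eq_diagonal : pauliZ = Matrix.diagonal zSign := by
  ext i j
  fin_cases i <;> fin_cases j <;> simp [pauliZ, zSign]

theorem pauliX_mul_self : pauliX * pauliX = 1 := by
  ext i j
  fin_cases i <;> fin_cases j <;> simp [pauliX]

theorem pauliY_mul_self : pauliY * pauliY = 1 := by
  ext i j
  fin_cases i <;> fin_cases j <;> simp [pauliY]

theorem pauliX_mul_pauliY : pauliX * pauliY = Complex.I • pauliZ := by
  ext i j
  fin_cases i <;> fin_cases j <;> simp [pauliX, pauliY, pauliZ]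

theorem pauliY_mul_pauliX : pauliY * pauliX = -(Complex.I • pauliZ) := by
  ext i j
  fin_cases i <;> fin_cases j <;> simp [pauliX, pauliY, pauliZ]

theorem pauliX_conjTranspose : pauliXᴴ = pauliX := by
  ext i j
  fin_cases i <;> fin_cases j <;> simp [pauliX]

theorem pauliY_conjTranspose : pauliYᴴ = pauliY := by
  ext i j
  fin_cases i <;> fin_cases j <;> simp [pauliY]

/-- `X` for index `0`, `Y` for index `1`. -/
def pauliXY (b : Fin 2) : OneQubitOp := if b = 0 then pauliX else pauliY

theorem pauliXY_mul_self (b : Fin 2) : pauliXY b * pauliXY b = 1 := by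
  unfold pauliXY; split_ifs
  exacts [pauliX_mul_self, pauliY_mul_self]

theorem pauliXY_conjTranspose (b : Fin 2) : (pauliXY b)ᴴ = pauliXY b := by
  unfold pauliXY; split_ifs
  exacts [pauliX_conjTranspose, pauliY_conjTranspose]

theorem pauliXY_anti {a b : Fin 2} (h : a ≠ b) :
    pauliXY a * pauliXY b = -(pauliXY b * pauliXY a) := by
  fin_cases a <;> fin_cases b <;> simp_all [pauliXY, pauliX_mul_pauliY, pauliY_mul_pauliX]

theorem pauliXY_support {b : Fin 2} {u v : Fin 2} (h : pauliXY b u v ≠ 0) :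
    zSign u = -zSign v := by
  fin_cases b <;> fin_cases u <;> fin_cases v <;> simp_all [pauliXY, pauliX, pauliY, zSign]

/-- The Jordan-Wigner string: the product of the operators `Z_l` with `l < j`. -/
def jwString (j : Fin n) : QubitOp n := Matrix.diagonal fun x => ∏ l with l < j, zSign (x l)

/-- The Majorana operators: the Jordan-Wigner string of `j` times `X_j` or `Y_j`. -/
def majorana (a : Fin n × Fin 2) : QubitOp n := jwString a.1 * onQubit a.1 (pauliXY a.2)

theorem jwString_mul_self (j : Fin n) : jwString j * jwString j = 1 := by
  rw [jwString, Matrix.diagonal_mul_diagonal, ← Matrix.diagonal_one]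
  congr 1
  ext x
  rw [← Finset.prod_mul_distrib]
  exact Finset.prod_eq_one fun l _ => zSign_mul_self _

theorem jwString_conjTranspose (j : Fin n) : (jwString j)ᴴ = jwString j := by
  rw [jwString, Matrix.diagonal_conjTranspose]
  congr 1
  ext x
  rw [Pi.star_apply, star_prod]
  refine Finset.prod_congr rfl fun l _ => ?_
  unfold zSign; split_ifs <;> simp

theorem commute_jwString (j k : Fin n) : Commute (jwString j) (jwString k) := by
  rw [commute_iff_eq, jwString, jwString, Matrix.diagonal_mul_diagonal,
    Matrix.diagonal_mul_diagonal]
  simp only [mul_comm]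

theorem commute_jwString_onQubit {j k : Fin n} (h : ¬ k < j) (A : OneQubitOp) :
    Commute (jwString j) (onQubit k A) := by
  refine commute_diagonal_of_support fun x y hxy => ?_
  refine Finset.prod_congr rfl fun l hl => ?_
  rw [(onQubit_support hxy).1 l]
  rintro rfl
  exact h (Finset.mem_filter.1 hl).2

theorem jwString_anti_onQubit {j k : Fin n} (h : k < j) (b : Fin 2) :
    jwString j * onQubit k (pauliXY b) = -(onQubit k (pauliXY b) * jwString j) := by
  ext x y
  rw [jwString, Matrix.diagonal_mul, Matrix.neg_apply, Matrix.mul_diagonal]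
  by_cases hM : onQubit k (pauliXY b) x y = 0
  · simp [hM]
  · obtain ⟨h1, h2⟩ := onQubit_support hM
    have hk : k ∈ Finset.univ.filter (· < j) := by simp [h]
    rw [← Finset.mul_prod_erase _ _ hk, ← Finset.mul_prod_erase _ (fun l => zSign (y l)) hk,
      pauliXY_support h2, Finset.prod_congr rfl fun l hl => by
        rw [h1 l (Finset.ne_of_mem_erase hl)]]
    ring

theorem majorana_conjTranspose (a : Fin n × Fin 2) : (majorana a)ᴴ = majorana a := by
  rw [majorana, Matrix.conjTranspose_mul, onQubit_conjTranspose, pauliXY_conjTranspose,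
    jwString_conjTranspose, (commute_jwString_onQubit (lt_irrefl _) _).eq]

theorem majorana_mul_same (j : Fin n) (a b : Fin 2) :
    majorana (j, a) * majorana (j, b) = onQubit j (pauliXY a * pauliXY b) := by
  simp only [majorana]
  rw [(commute_jwString_onQubit (lt_irrefl j) (pauliXY a)).eq, mul_assoc, ← mul_assoc (jwString j),
    jwString_mul_self, one_mul, onQubit_mul]

theorem majorana_mul_self (a : Fin n × Fin 2) : majorana a * majorana a = 1 := by
  obtain ⟨j, b⟩ := a
  rw [majorana_mul_same, pauliXY_mul_self, onQubit_one]

theorem majorana_anti {a b : Fin n × Fin 2} (h : a ≠ b) :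
    majorana a * majorana b = -(majorana b * majorana a) := by
  have key : ∀ (j k : Fin n) (a b : Fin 2), j < k →
      majorana (j, a) * majorana (k, b) = -(majorana (k, b) * majorana (j, a)) := by
    intro j k a b hjk
    simp only [majorana]
    calc jwString j * onQubit j (pauliXY a) * (jwString k * onQubit k (pauliXY b))
        = jwString j * (onQubit j (pauliXY a) * jwString k) * onQubit k (pauliXY b) := by
          simp only [mul_assoc]
      _ = -(jwString j * jwString k * (onQubit j (pauliXY a) * onQubit k (pauliXY b))) := by
          rw [← neg_eq_iff_eq_neg.2 (jwString_anti_onQubit hjk a)]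
          simp only [mul_neg, neg_mul, mul_assoc]
      _ = -(jwString k * (jwString j * onQubit k (pauliXY b)) * onQubit j (pauliXY a)) := by
          rw [(commute_jwString j k).eq, (commute_onQubit_onQubit hjk.ne _ _).eq]
          simp only [mul_assoc]
      _ = _ := by
          rw [(commute_jwString_onQubit hjk.not_gt _).eq]
          simp only [mul_assoc]
  obtain ⟨j, a⟩ := a
  obtain ⟨k, b⟩ := b
  rcases lt_trichotomy j k with hjk | rfl | hjk
  · exact key j k a b hjk
  · have hab : a ≠ b := fun hab => h (by rw [hab])
    rw [majorana_mul_same, majorana_mul_same, pauliXY_anti hab]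
    ext x y
    simp only [onQubit, Matrix.neg_apply]
    split_ifs <;> simp
  · rw [key k j b a hjk, neg_neg]

end LocalOperators

section Witness

/-! ### Gaussian unitaries preserve the span of the Majorana operators -/

/-- The real span of self-adjoint, anticommuting unitaries is a Majorana space. -/
theorem isMajoranaSpace_span {A ι : Type*} [Ring A] [StarRing A] [Algebra ℝ A] [StarModule ℝ A]
    [Nontrivial A] [Fintype ι] [DecidableEq ι] {γ : ι → A} (hs : ∀ a, star (γ a) = γ a)
    (h1 : ∀ a, γ a * γ a = 1) (h2 : ∀ a b, a ≠ b → γ a * γ b = -(γ b * γ a)) :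
    IsMajoranaSpace (Submodule.span ℝ (Set.range γ)) := by
  -- the mixed terms of the square cancel in pairs, so twice the square is considered
  have key : ∀ v : ι → ℝ, (∑ a, v a • γ a) * (∑ a, v a • γ a) = (∑ a, v a ^ 2) • (1 : A) := by
    intro v
    have e : (2 : ℝ) • ((∑ a, v a • γ a) * (∑ a, v a • γ a)) =
        (2 : ℝ) • ((∑ a, v a ^ 2) • (1 : A)) := by
      calc (2 : ℝ) • ((∑ a, v a • γ a) * (∑ a, v a • γ a))
          = ∑ a, ∑ b, (v a * v b) • (γ a * γ b) + ∑ a, ∑ b, (v a * v b) • (γ a * γ b) := by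
            rw [two_smul]
            simp only [Finset.sum_mul_sum, smul_mul_smul_comm]
        _ = ∑ a, ∑ b, (v a * v b) • (γ a * γ b + γ b * γ a) := by
            nth_rw 2 [Finset.sum_comm]
            simp only [← Finset.sum_add_distrib, smul_add]
            simp only [mul_comm]
        _ = ∑ a, (v a * v a) • (γ a * γ a + γ a * γ a) := by
            refine Finset.sum_congr rfl fun a _ => Finset.sum_eq_single a (fun b _ hb => ?_) ?_
            · rw [h2 a b hb.symm, neg_add_cancel, smul_zero]
            · simp
        _ = _ := by
            simp only [h1, ← pow_two, Finset.sum_smul, Finset.smul_sum, ← two_smul ℝ (1 : A),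
              smul_comm (2 : ℝ)]
    exact smul_right_injective A (two_ne_zero (α := ℝ)) e
  constructor
  · intro w hw
    obtain ⟨v, rfl⟩ := (Submodule.mem_span_range_iff_exists_fun ℝ).1 hw
    simp [star_sum, hs]
  · intro w hw
    obtain ⟨v, rfl⟩ := (Submodule.mem_span_range_iff_exists_fun ℝ).1 hw
    exact ⟨_, Finset.sum_nonneg fun a _ => sq_nonneg _, key v⟩
  · intro w hw h0
    obtain ⟨v, rfl⟩ := (Submodule.mem_span_range_iff_exists_fun ℝ).1 hw
    rw [key, smul_eq_zero, or_iff_left one_ne_zero,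
      Finset.sum_eq_zero_iff_of_nonneg fun a _ => sq_nonneg _] at h0
    refine Finset.sum_eq_zero fun a ha => ?_
    rw [pow_eq_zero_iff two_ne_zero |>.1 (h0 a ha), zero_smul]

variable {n : ℕ}

/-- The real span of the Majorana operators. -/
noncomputable def majoranaSpace (n : ℕ) : Submodule ℝ (QubitOp n) :=
  Submodule.span ℝ (Set.range majorana)

theorem isMajoranaSpace_majoranaSpace : IsMajoranaSpace (majoranaSpace n) :=
  isMajoranaSpace_span majorana_conjTranspose majorana_mul_self fun _ _ h => majorana_anti h

theorem majorana_mem (a : Fin n × Fin 2) : majorana a ∈ majoranaSpace n :=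
  Submodule.subset_span ⟨a, rfl⟩

theorem isFree_of_majorana {K : QubitOp n} (hK : K ∈ unitary (QubitOp n))
    (h1 : ∀ a, K * majorana a * star K ∈ majoranaSpace n)
    (h2 : ∀ a, star K * majorana a * K ∈ majoranaSpace n) : IsFree (majoranaSpace n) K := by
  have key : ∀ K L : QubitOp n, (∀ a, K * majorana a * L ∈ majoranaSpace n) →
      ∀ w ∈ majoranaSpace n, K * w * L ∈ majoranaSpace n := by
    intro K L h w hw
    obtain ⟨v, rfl⟩ := (Submodule.mem_span_range_iff_exists_fun ℝ).1 hw
    rw [Finset.mul_sum, Finset.sum_mul]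
    refine Submodule.sum_mem _ fun a _ => ?_
    rw [mul_smul_comm, smul_mul_assoc]
    exact Submodule.smul_mem _ _ (h a)
  exact ⟨hK, key _ _ h1, key _ _ h2⟩

theorem onQubit_pauliXY_mul_self (j : Fin n) (b : Fin 2) :
    onQubit j (pauliXY b) * onQubit j (pauliXY b) = 1 := by
  rw [onQubit_mul, pauliXY_mul_self, onQubit_one]

/-- The Pauli gates `X_j` and `Y_j` map every Majorana operator to itself up to sign. -/
theorem isFree_onQubit_pauliXY (j : Fin n) (b : Fin 2) :
    IsFree (majoranaSpace n) (onQubit j (pauliXY b)) := by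
  have hs : star (onQubit j (pauliXY b)) = onQubit j (pauliXY b) := by
    rw [Matrix.star_eq_conjTranspose, onQubit_conjTranspose, pauliXY_conjTranspose]
  have h1 := onQubit_pauliXY_mul_self j b
  have key : ∀ a, onQubit j (pauliXY b) * majorana a * onQubit j (pauliXY b) ∈
      majoranaSpace n := by
    have hXA : ∀ (l : Fin n) (a : Fin 2),
        onQubit j (pauliXY b) * onQubit l (pauliXY a) =
          onQubit l (pauliXY a) * onQubit j (pauliXY b) ∨
        onQubit j (pauliXY b) * onQubit l (pauliXY a) =
          -(onQubit l (pauliXY a) * onQubit j (pauliXY b)) := by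
      intro l a
      by_cases hl : j = l
      · subst hl
        by_cases hab : b = a
        · left; rw [hab]
        · right
          rw [onQubit_mul, onQubit_mul, pauliXY_anti hab]
          ext x y
          simp only [onQubit, Matrix.neg_apply]
          split_ifs <;> simp
      · left
        exact commute_onQubit_onQubit hl _ _
    have hXJ : ∀ l : Fin n,
        onQubit j (pauliXY b) * jwString l = jwString l * onQubit j (pauliXY b) ∨
        onQubit j (pauliXY b) * jwString l = -(jwString l * onQubit j (pauliXY b)) := by
      intro l
      by_cases hl : j < l
      · right; rw [jwString_anti_onQubit hl, neg_neg]
      · left; exact (commute_jwString_onQubit hl _).eq.symm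
    rintro ⟨l, a⟩
    have : onQubit j (pauliXY b) * majorana (l, a) * onQubit j (pauliXY b) = majorana (l, a) ∨
        onQubit j (pauliXY b) * majorana (l, a) * onQubit j (pauliXY b) = -majorana (l, a) := by
      set e := onQubit j (pauliXY b)
      have hee : ∀ d x : QubitOp n, d * e * (e * x) = d * x := fun d x => by
        rw [mul_assoc, ← mul_assoc e, h1, one_mul]
      have hassoc : e * majorana (l, a) * e = e * jwString l * (onQubit l (pauliXY a) * e) := by
        simp only [majorana, mul_assoc]
      rw [hassoc]
      rcases hXJ l with h | h <;> rcases hXA l a with h' | h' <;> rw [h]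
      · left; rw [← h', hee]; rfl
      · right; rw [← neg_eq_iff_eq_neg.2 h', mul_neg, hee]; rfl
      · right; rw [← h', neg_mul, hee]; rfl
      · left; rw [← neg_eq_iff_eq_neg.2 h', mul_neg, neg_mul, neg_neg, hee]; rfl
    rcases this with h | h <;> rw [h]
    · exact majorana_mem _
    · exact Submodule.neg_mem _ (majorana_mem _)
  refine isFree_of_majorana ?_ ?_ ?_
  · exact Unitary.mem_iff.2 ⟨by rw [hs, h1], by rw [hs, h1]⟩
  · rw [hs]; exact key
  · rw [hs]; exact key

/-- The entries of a two by two unitary, in terms of its first row and its determinant. -/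
theorem unitary_fin_two {A : OneQubitOp} (hA : A ∈ Matrix.unitaryGroup (Fin 2) ℂ) :
    A 1 0 = -(A.det * star (A 0 1)) ∧ A 1 1 = A.det * star (A 0 0) ∧ A.det * star A.det = 1 ∧
      A 0 0 * star (A 0 0) + A 0 1 * star (A 0 1) = 1 := by
  have h := Matrix.mem_unitaryGroup_iff.1 hA
  have hadj : A.adjugate = A.det • star A := by
    calc A.adjugate = A.adjugate * (A * star A) := by rw [h, mul_one]
      _ = _ := by rw [← mul_assoc, Matrix.adjugate_mul, smul_mul_assoc, one_mul]
  rw [Matrix.adjugate_fin_two] at hadj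
  have e1 := congrFun (congrFun hadj 0) 0
  have e2 := congrFun (congrFun hadj 1) 0
  have e3 := congrArg Matrix.det h
  have e4 := congrFun (congrFun h 0) 0
  simp [Matrix.star_eq_conjTranspose, Matrix.mul_apply, Fin.sum_univ_two,
    Matrix.det_conjTranspose] at e1 e2 e3 e4
  refine ⟨by rw [← neg_eq_iff_eq_neg]; simpa using e2, by simpa using e1, by simpa using e3,
    by simpa using e4⟩

/-- The real span of `X ⊗ 1`, `Y ⊗ 1`, `Z ⊗ X`, `Z ⊗ Y`: in the order `|00⟩, |11⟩` of the even
and `|01⟩, |10⟩` of the odd basis vectors, the block from the even to the odd space is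
`!![z, w; conj w, -conj z]`. -/
noncomputable def oddOp (z w : ℂ) : TwoQubitOp :=
  w.re • (pauliX ⊗ₖ (1 : OneQubitOp)) + (-w.im) • (pauliY ⊗ₖ (1 : OneQubitOp)) +
    (z.re • (pauliZ ⊗ₖ pauliX) + z.im • (pauliZ ⊗ₖ pauliY))

theorem oddOp_apply (z w : ℂ) (x y : Fin 2 × Fin 2) : oddOp z w x y =
    if x.1 = x.2 then
      if y.1 = y.2 then 0 else
        if x.1 = 0 then (if y.1 = 0 then star z else w) else (if y.1 = 0 then star w else -z)
    else if y.1 = y.2 then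
      if x.1 = 0 then (if y.1 = 0 then z else w) else (if y.1 = 0 then star w else -star z)
    else 0 := by
  obtain ⟨x1, x2⟩ := x
  obtain ⟨y1, y2⟩ := y
  fin_cases x1 <;> fin_cases x2 <;> fin_cases y1 <;> fin_cases y2 <;>
  simp [oddOp, pauliX, pauliY, pauliZ, Matrix.one_apply, Complex.ext_iff]

/-- Matchgates act on the four Majorana operators of two neighbouring qubits by a real linear
map. This is where the condition `det A = det B` enters. -/
theorem exists_matchgate_conj_oddOp {A B : OneQubitOp} (hA : A ∈ Matrix.unitaryGroup (Fin 2) ℂ)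
    (hB : B ∈ Matrix.unitaryGroup (Fin 2) ℂ) (hAB : A.det = B.det) (z w : ℂ) :
    ∃ z' w', matchgate A B * oddOp z w * (matchgate A B)ᴴ = oddOp z' w' := by
  obtain ⟨hA1, hA2, hd, -⟩ := unitary_fin_two hA
  obtain ⟨hB1, hB2, -, -⟩ := unitary_fin_two hB
  rw [← hAB] at hB1 hB2
  generalize A.det = δ at *
  refine ⟨(B 0 0 * z + B 0 1 * star w) * star (A 0 0) + (B 0 0 * w - B 0 1 * star z) * star (A 0 1),
    (B 0 0 * z + B 0 1 * star w) * star (A 1 0) + (B 0 0 * w - B 0 1 * star z) * star (A 1 1), ?_⟩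
  simp only [RCLike.star_def] at hd ⊢
  ext ⟨x1, x2⟩ ⟨y1, y2⟩
  rw [oddOp_apply]
  simp only [Matrix.mul_apply, Fintype.sum_prod_type, Fin.sum_univ_two, Matrix.conjTranspose_apply,
    oddOp_apply, matchgate]
  fin_cases x1 <;> fin_cases x2 <;> fin_cases y1 <;> fin_cases y2 <;>
  simp [hA1, hA2, hB1, hB2]
  all_goals first
    | ring1
    | (left; ring1)
    | linear_combination (-((starRingEnd ℂ (B 0 0) * starRingEnd ℂ w -
        starRingEnd ℂ (B 0 1) * z) * A 0 1) - (starRingEnd ℂ (B 0 0) * starRingEnd ℂ z +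
        starRingEnd ℂ (B 0 1) * w) * A 0 0) * hd
    | linear_combination (-((B 0 0 * w - B 0 1 * starRingEnd ℂ z) * starRingEnd ℂ (A 0 1)) -
        (B 0 0 * z + B 0 1 * starRingEnd ℂ w) * starRingEnd ℂ (A 0 0)) * hd

end Witness

section GaussianFree

variable {n : ℕ}

theorem matchgate_mul (A B C D : OneQubitOp) :
    matchgate A B * matchgate C D = matchgate (A * C) (B * D) := by
  ext ⟨x1, x2⟩ ⟨y1, y2⟩
  fin_cases x1 <;> fin_cases x2 <;> fin_cases y1 <;> fin_cases y2 <;>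
  simp [Matrix.mul_apply, Fintype.sum_prod_type, Fin.sum_univ_two, matchgate, add_comm]

theorem matchgate_one : matchgate 1 1 = 1 := by
  ext ⟨x1, x2⟩ ⟨y1, y2⟩
  fin_cases x1 <;> fin_cases x2 <;> fin_cases y1 <;> fin_cases y2 <;>
  simp [matchgate, Matrix.one_apply]

theorem matchgate_conjTranspose (A B : OneQubitOp) :
    (matchgate A B)ᴴ = matchgate Aᴴ Bᴴ := by
  ext ⟨x1, x2⟩ ⟨y1, y2⟩
  fin_cases x1 <;> fin_cases x2 <;> fin_cases y1 <;> fin_cases y2 <;>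
  simp [matchgate]

theorem matchgate_mem_unitaryGroup {A B : OneQubitOp} (hA : A ∈ Matrix.unitaryGroup (Fin 2) ℂ)
    (hB : B ∈ Matrix.unitaryGroup (Fin 2) ℂ) :
    matchgate A B ∈ Matrix.unitaryGroup (Fin 2 × Fin 2) ℂ := by
  rw [Matrix.mem_unitaryGroup_iff] at *
  rw [Matrix.star_eq_conjTranspose] at *
  rw [matchgate_conjTranspose, matchgate_mul, hA, hB, matchgate_one]

theorem onPair_mem_unitaryGroup {j k : Fin n} (hjk : j ≠ k) {M : TwoQubitOp}
    (hM : M ∈ Matrix.unitaryGroup (Fin 2 × Fin 2) ℂ) :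
    onPair j k M ∈ Matrix.unitaryGroup (Fin n → Fin 2) ℂ := by
  rw [Matrix.mem_unitaryGroup_iff] at *
  rw [Matrix.star_eq_conjTranspose] at *
  rw [onPair_conjTranspose, onPair_mul hjk, hM, onPair_one]

theorem matchgate_support {A B : OneQubitOp} {x y : Fin 2 × Fin 2} (h : matchgate A B x y ≠ 0) :
    zSign x.1 * zSign x.2 = zSign y.1 * zSign y.2 := by
  obtain ⟨x1, x2⟩ := x
  obtain ⟨y1, y2⟩ := y
  fin_cases x1 <;> fin_cases x2 <;> fin_cases y1 <;> fin_cases y2 <;>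
  simp_all [matchgate, zSign]

theorem commute_jwString_onPair_of_not_lt {j k l : Fin n} (hj : ¬ j < l) (hk : ¬ k < l)
    (M : TwoQubitOp) : Commute (jwString l) (onPair j k M) := by
  refine commute_diagonal_of_support fun x y hxy => ?_
  refine Finset.prod_congr rfl fun m hm => ?_
  have hm' := (Finset.mem_filter.1 hm).2
  rw [(onPair_support hxy).1 m (fun h => hj (h ▸ hm')) (fun h => hk (h ▸ hm'))]

theorem commute_jwString_onPair_matchgate {j k l : Fin n} (hjk : j ≠ k) (hj : j < l) (hk : k < l)
    (A B : OneQubitOp) : Commute (jwString l) (onPair j k (matchgate A B)) := by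
  refine commute_diagonal_of_support fun x y hxy => ?_
  obtain ⟨h1, h2⟩ := onPair_support hxy
  have hj' : j ∈ Finset.univ.filter (· < l) := by simp [hj]
  have hk' : k ∈ (Finset.univ.filter (· < l)).erase j := by simp [hk, hjk.symm]
  have h3 : ∀ z : Fin n → Fin 2, ∏ m with m < l, zSign (z m) = zSign (z j) * zSign (z k) *
      ∏ m ∈ ((Finset.univ.filter (· < l)).erase j).erase k, zSign (z m) := fun z => by
    rw [← Finset.mul_prod_erase _ _ hj', ← Finset.mul_prod_erase _ _ hk', mul_assoc]
  rw [h3, h3, matchgate_support h2]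
  congr 1
  refine Finset.prod_congr rfl fun m hm => ?_
  rw [h1 m (Finset.ne_of_mem_erase (Finset.mem_of_mem_erase hm)) (Finset.ne_of_mem_erase hm)]

theorem onQubit_diagonal (j : Fin n) (f : Fin 2 → ℂ) :
    onQubit j (Matrix.diagonal f) = Matrix.diagonal fun x => f (x j) := by
  ext x y
  simp only [onQubit, Matrix.diagonal_apply]
  by_cases h : x = y
  · simp [h]
  · rw [if_neg h]
    split_ifs with h1 h2
    · exact absurd (funext fun l => by
        by_cases hl : l = j
        · rw [hl, h2]
        · exact h1 l hl) h
    · rfl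
    · rfl

theorem jwString_succ {j k : Fin n} (hjk : (j : ℕ) + 1 = k) :
    jwString k = jwString j * onQubit j pauliZ := by
  rw [pauliZ_eq_diagonal, onQubit_diagonal, jwString, jwString, Matrix.diagonal_mul_diagonal]
  congr 1
  ext x
  have : Finset.univ.filter (· < k) = insert j (Finset.univ.filter (· < j)) := by
    ext l
    simp only [Finset.mem_filter, Finset.mem_univ, true_and, Finset.mem_insert, Fin.lt_def,
      Fin.ext_iff]
    omega
  rw [this, Finset.prod_insert (by simp), mul_comm]

theorem onPair_real_smul (j k : Fin n) (r : ℝ) (A : TwoQubitOp) :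
    onPair j k (r • A) = r • onPair j k A := by
  ext x y
  simp only [onPair, Matrix.smul_apply]
  split_ifs <;> simp

/-- For neighbouring qubits the operators `oddOp z w` are, up to the Jordan-Wigner string, the real
linear combinations of the four Majorana operators of the two qubits. -/
theorem jwString_mul_onPair_oddOp {j k : Fin n} (hjk : (j : ℕ) + 1 = k) (z w : ℂ) :
    jwString j * onPair j k (oddOp z w) = w.re • majorana (j, 0) + (-w.im) • majorana (j, 1) +
      (z.re • majorana (k, 0) + z.im • majorana (k, 1)) := by
  have hne : j ≠ k := fun h => by rw [h] at hjk; omega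
  simp only [oddOp, onPair_add, onPair_real_smul, onPair_kronecker hne, onQubit_one, mul_one,
    mul_add, mul_smul_comm, majorana, jwString_succ hjk, pauliXY, mul_assoc]
  simp

/-- Nearest neighbour matchgates preserve the span of the Majorana operators. -/
theorem isFree_onPair_matchgate {j k : Fin n} (hjk : (j : ℕ) + 1 = k) {A B : OneQubitOp}
    (hA : A ∈ Matrix.unitaryGroup (Fin 2) ℂ) (hB : B ∈ Matrix.unitaryGroup (Fin 2) ℂ)
    (hAB : A.det = B.det) : IsFree (majoranaSpace n) (onPair j k (matchgate A B)) := by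
  have hne : j ≠ k := fun h => by rw [h] at hjk; omega
  have hodd : ∀ {A B : OneQubitOp}, A ∈ Matrix.unitaryGroup (Fin 2) ℂ →
      B ∈ Matrix.unitaryGroup (Fin 2) ℂ → A.det = B.det → ∀ z w : ℂ,
      onPair j k (matchgate A B) * (jwString j * onPair j k (oddOp z w)) *
        star (onPair j k (matchgate A B)) ∈ majoranaSpace n := by
    intro A B hA hB hAB z w
    obtain ⟨z', w', h⟩ := exists_matchgate_conj_oddOp hA hB hAB z w
    have hlt : ¬ k < j := by rw [Fin.lt_def]; omega
    have : onPair j k (matchgate A B) * (jwString j * onPair j k (oddOp z w)) *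
        star (onPair j k (matchgate A B)) = jwString j * onPair j k (oddOp z' w') := by
      rw [← mul_assoc, ← (commute_jwString_onPair_of_not_lt (lt_irrefl j) hlt _).eq,
        Matrix.star_eq_conjTranspose, onPair_conjTranspose, mul_assoc, mul_assoc,
        onPair_mul hne, onPair_mul hne, ← mul_assoc, h]
    rw [this, jwString_mul_onPair_oddOp hjk]
    exact add_mem (add_mem (Submodule.smul_mem _ _ (majorana_mem _))
      (Submodule.smul_mem _ _ (majorana_mem _))) (add_mem (Submodule.smul_mem _ _ (majorana_mem _))
      (Submodule.smul_mem _ _ (majorana_mem _)))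
  have key : ∀ {A B : OneQubitOp}, A ∈ Matrix.unitaryGroup (Fin 2) ℂ →
      B ∈ Matrix.unitaryGroup (Fin 2) ℂ → A.det = B.det → ∀ a,
      onPair j k (matchgate A B) * majorana a * star (onPair j k (matchgate A B)) ∈
        majoranaSpace n := by
    intro A B hA hB hAB
    rintro ⟨l, b⟩
    by_cases hlj : l = j
    · subst hlj
      have : majorana (l, b) =
          jwString l * onPair l k (oddOp 0 (if b = 0 then 1 else -Complex.I)) := by
        rw [jwString_mul_onPair_oddOp hjk]
        fin_cases b <;> simp
      rw [this]
      exact hodd hA hB hAB _ _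
    by_cases hlk : l = k
    · subst hlk
      have : majorana (l, b) =
          jwString j * onPair j l (oddOp (if b = 0 then 1 else Complex.I) 0) := by
        rw [jwString_mul_onPair_oddOp hjk]
        fin_cases b <;> simp
      rw [this]
      exact hodd hA hB hAB _ _
    have hcomm : Commute (majorana (l, b)) (onPair j k (matchgate A B)) := by
      refine Commute.mul_left ?_ (commute_onQubit_onPair hlj hlk _ _)
      by_cases hl : j < l
      · refine commute_jwString_onPair_matchgate hne hl ?_ _ _
        rw [Fin.lt_def] at *
        rw [Fin.ext_iff] at hlk
        omega
      · refine commute_jwString_onPair_of_not_lt hl ?_ _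
        rw [Fin.lt_def] at *
        omega
    have hu := (Matrix.mem_unitaryGroup_iff.1 (onPair_mem_unitaryGroup hne
      (matchgate_mem_unitaryGroup hA hB)))
    rw [← hcomm.eq, mul_assoc, hu, mul_one]
    exact majorana_mem _
  have hs : star (onPair j k (matchgate A B)) = onPair j k (matchgate (star A) (star B)) := by
    rw [Matrix.star_eq_conjTranspose, onPair_conjTranspose, matchgate_conjTranspose]
    rfl
  refine isFree_of_majorana (onPair_mem_unitaryGroup hne (matchgate_mem_unitaryGroup hA hB))
    (key hA hB hAB) fun a => ?_
  have := key (Unitary.star_mem hA) (Unitary.star_mem hB) (by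
    rw [Matrix.star_eq_conjTranspose, Matrix.star_eq_conjTranspose, Matrix.det_conjTranspose,
      Matrix.det_conjTranspose, hAB]) a
  rwa [← hs, star_star] at this

/-- Gaussian unitaries preserve the span of the Majorana operators. -/
theorem IsGaussian.isFree {K : QubitOp n} (hK : IsGaussian K) : IsFree (majoranaSpace n) K := by
  obtain ⟨g, hg, rfl⟩ := hK
  induction hg using Subgroup.closure_induction with
  | mem g hg =>
    rcases hg with ⟨j, k, hjk, A, hA, B, hB, hAB, h⟩ | ⟨j, h | h⟩
    · rw [h]
      exact isFree_onPair_matchgate hjk hA hB hAB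
    · rw [h]
      exact isFree_onQubit_pauliXY j 0
    · rw [h]
      exact isFree_onQubit_pauliXY j 1
  | one => exact IsFree.one
  | mul g h _ _ hg hh => exact hg.mul hh
  | inv g _ hg => exact hg.star

/-! ### The dual witness -/

/-- The diagonal operator `∏ (a + b Z_j Z_k)`, where the product is over the pairs of qubits
`(J s, K s)` with `s ∈ T`. -/
noncomputable def pairDiagonal {σ : Type*} (J K : σ → Fin n) (a b : ℂ) (T : Finset σ) : QubitOp n :=
  Matrix.diagonal fun x => ∏ s ∈ T, (a + b * (zSign (x (J s)) * zSign (x (K s))))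

/-- The four Majorana operators of the qubits `j` and `k`. -/
noncomputable def pairBlock (j k : Fin n) : Fin 4 → QubitOp n :=
  ![majorana (j, 0), majorana (j, 1), majorana (k, 0), majorana (k, 1)]

theorem isBlock_pairBlock {j k : Fin n} (hjk : j ≠ k) :
    IsBlock (majoranaSpace n) (pairBlock j k) := by
  refine ⟨fun i => ?_, fun i => ?_, fun i i' h => ?_⟩
  · fin_cases i <;> exact majorana_mem _
  · fin_cases i <;> exact majorana_mul_self _
  · fin_cases i <;> fin_cases i' <;>
    first
    | exact absurd rfl h
    | exact majorana_anti (by simp [hjk, hjk.symm])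

theorem blockParity_pairBlock (j k : Fin n) :
    blockParity (pairBlock j k) = Matrix.diagonal fun x => -(zSign (x j) * zSign (x k)) := by
  have h1 : ∀ l : Fin n, majorana (l, 0) * majorana (l, 1) =
      Matrix.diagonal fun x => Complex.I * zSign (x l) := by
    intro l
    rw [majorana_mul_same]
    simp only [pauliXY, if_true, one_ne_zero, if_false, pauliX_mul_pauliY, pauliZ_eq_diagonal,
      onQubit_smul, onQubit_diagonal]
    ext x y
    simp [Matrix.diagonal_apply]
  change majorana (j, 0) * majorana (j, 1) * majorana (k, 0) * majorana (k, 1) = _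
  rw [mul_assoc _ (majorana (k, 0)), h1, h1, Matrix.diagonal_mul_diagonal]
  congr 1
  ext x
  linear_combination (zSign (x j) * zSign (x k)) * Complex.I_mul_I

theorem commute_majorana_diagonal {l : Fin n} {b : Fin 2} {d : (Fin n → Fin 2) → ℂ}
    (h : ∀ x y, (∀ m, m ≠ l → x m = y m) → d x = d y) :
    Commute (majorana (l, b)) (Matrix.diagonal d) := by
  refine Commute.mul_left ?_ ?_
  · rw [commute_iff_eq, jwString, Matrix.diagonal_mul_diagonal, Matrix.diagonal_mul_diagonal]
    simp only [mul_comm]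
  · exact (commute_diagonal_of_support fun x y hxy => h x y (onQubit_support hxy).1).symm

variable {σ : Type*} [DecidableEq σ] {J K : σ → Fin n}

theorem commute_pairBlock_pairDiagonal {a b : ℂ} {T : Finset σ}
    (hdis : ∀ s s', s ≠ s' → J s ≠ J s' ∧ J s ≠ K s' ∧ K s ≠ J s' ∧ K s ≠ K s')
    {s : σ} (hs : s ∉ T) (i : Fin 4) :
    pairBlock (J s) (K s) i * pairDiagonal J K a b T =
      pairDiagonal J K a b T * pairBlock (J s) (K s) i := by
  have h : ∀ l, (l = J s ∨ l = K s) → ∀ e, Commute (majorana (l, e)) (pairDiagonal J K a b T) := by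
    intro l hl e
    refine commute_majorana_diagonal fun x y hxy => ?_
    refine Finset.prod_congr rfl fun s' hs' => ?_
    obtain ⟨h1, h2, h3, h4⟩ := hdis s' s (fun h => hs (h ▸ hs'))
    rcases hl with rfl | rfl
    · rw [hxy _ h1, hxy _ h3]
    · rw [hxy _ h2, hxy _ h4]
  fin_cases i
  exacts [h _ (Or.inl rfl) _, h _ (Or.inl rfl) _, h _ (Or.inr rfl) _, h _ (Or.inr rfl) _]

theorem trace_pairDiagonal (hJK : ∀ s, J s ≠ K s)
    (hdis : ∀ s s', s ≠ s' → J s ≠ J s' ∧ J s ≠ K s' ∧ K s ≠ J s' ∧ K s ≠ K s')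
    (a b : ℂ) (T : Finset σ) :
    (pairDiagonal J K a b T).trace = a ^ T.card * 2 ^ n := by
  induction T using Finset.induction_on with
  | empty => simp [pairDiagonal, Matrix.trace]
  | insert s T hs ih =>
    have hc := isBlock_pairBlock (hJK s)
    have e : pairDiagonal J K a b (insert s T) = a • pairDiagonal J K a b T +
        (-b) • (blockParity (pairBlock (J s) (K s)) * pairDiagonal J K a b T) := by
      rw [blockParity_pairBlock, pairDiagonal, pairDiagonal, Matrix.diagonal_mul_diagonal,
        ← Matrix.diagonal_smul, ← Matrix.diagonal_smul, Matrix.diagonal_add]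
      congr 1
      ext x
      rw [Finset.prod_insert hs]
      simp
      ring
    have h0 := trace_eq_zero_of_anti (τ := Matrix.traceLinearMap (Fin n → Fin 2) ℝ ℂ)
      (fun x y => Matrix.trace_mul_comm x y) (hc.sq 0) (hc.blockParity_anti 0)
      (commute_pairBlock_pairDiagonal (a := a) (b := b) hdis hs 0)
    rw [Matrix.traceLinearMap_apply] at h0
    rw [e, Matrix.trace_add, Matrix.trace_smul, Matrix.trace_smul, h0, ih,
      Finset.card_insert_of_notMem hs]
    simp
    ring

/-- The dual witness: for signs `ε = ±1` the operator `∏ (1 - i ε Z_j Z_k)` has absolute normalized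
trace at most one against every free unitary. -/
theorem norm_trace_mul_pairDiagonal_le (hJK : ∀ s, J s ≠ K s)
    (hdis : ∀ s s', s ≠ s' → J s ≠ J s' ∧ J s ≠ K s' ∧ K s ≠ J s' ∧ K s ≠ K s')
    {ε : ℝ} (hε : ε ^ 2 = 1) (T : Finset σ) {V : QubitOp n} (hV : IsFree (majoranaSpace n) V) :
    ‖(V * pairDiagonal J K 1 (-(ε * Complex.I)) T).trace‖ ≤ 2 ^ n := by
  induction T using Finset.induction_on generalizing V with
  | empty =>
    have : pairDiagonal J K 1 (-(ε * Complex.I)) ∅ = 1 := by simp [pairDiagonal]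
    rw [this, mul_one]
    calc ‖V.trace‖ ≤ ∑ x, ‖V x x‖ := norm_sum_le _ _
      _ ≤ ∑ _x : Fin n → Fin 2, (1 : ℝ) :=
        Finset.sum_le_sum fun x _ => entry_norm_bound_of_unitary hV.unitary x x
      _ = 2 ^ n := by simp
  | insert s T hs ih =>
    have e : pairDiagonal J K 1 (-(ε * Complex.I)) (insert s T) =
        pairDiagonal J K 1 (-(ε * Complex.I)) T *
          (1 + ε • ((Complex.I • 1) * blockParity (pairBlock (J s) (K s)))) := by
      rw [blockParity_pairBlock, pairDiagonal, pairDiagonal, smul_mul_assoc, one_mul,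
        ← Matrix.diagonal_smul, ← Matrix.diagonal_smul, ← Matrix.diagonal_one, Matrix.diagonal_add,
        Matrix.diagonal_mul_diagonal]
      congr 1
      ext x
      rw [Finset.prod_insert hs]
      simp
      ring
    rw [e]
    exact (isBlock_pairBlock (hJK s)).norm_trace_le isMajoranaSpace_majoranaSpace
      (τ := Matrix.traceLinearMap (Fin n → Fin 2) ℝ ℂ) (fun x y => Matrix.trace_mul_comm x y)
      (fun x => by simp) (fun x => by simp) (by positivity) (fun K hK => ih hK)
      (fun i => commute_pairBlock_pairDiagonal hdis hs i) hε hV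

/-- The lower bound on decompositions of a product of pair rotations, up to a free unitary. -/
theorem pow_le_sum_norm [Fintype σ] (hJK : ∀ s, J s ≠ K s)
    (hdis : ∀ s s', s ≠ s' → J s ≠ J s' ∧ J s ≠ K s' ∧ K s ≠ J s' ∧ K s ≠ K s')
    {C S : ℝ} {G V : QubitOp n} (hG : IsFree (majoranaSpace n) G)
    (hV : V = G * pairDiagonal J K C (-(Complex.I * S)) Finset.univ)
    {ι : Type} [Fintype ι] {c : ι → ℂ} {L : ι → QubitOp n} (h : IsFeasible V c L) :
    (|C| + |S|) ^ Fintype.card σ ≤ ∑ i, ‖c i‖ := by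
  -- pairing `C - i S z` with `1 - i ε z`, where `z ^ 2 = 1`, leaves the scalar term `C - ε S`; the
  -- sign `ε` makes its absolute value as large as possible
  obtain ⟨ε, hε, hCS⟩ : ∃ ε : ℝ, ε ^ 2 = 1 ∧ |C - ε * S| = |C| + |S| := by
    rcases abs_cases C with ⟨h1, h1'⟩ | ⟨h1, h1'⟩ <;> rcases abs_cases S with ⟨h2, h2'⟩ | ⟨h2, h2'⟩
    · exact ⟨-1, by norm_num, by rw [h1, h2, abs_of_nonneg (by linarith)]; ring⟩
    · exact ⟨1, by norm_num, by rw [h1, h2, abs_of_nonneg (by linarith)]; ring⟩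
    · exact ⟨1, by norm_num, by rw [h1, h2, abs_of_nonpos (by linarith)]; ring⟩
    · exact ⟨-1, by norm_num, by rw [h1, h2, abs_of_nonpos (by linarith)]; ring⟩
  set D := pairDiagonal J K 1 (-(ε * Complex.I)) Finset.univ with hD
  have h1 : star G * V * D =
      pairDiagonal J K ((C - ε * S : ℝ) : ℂ) (-(Complex.I * (S + ε * C))) Finset.univ := by
    rw [hV, ← mul_assoc, hG.star_mul_self, one_mul, hD, pairDiagonal, pairDiagonal, pairDiagonal,
      Matrix.diagonal_mul_diagonal]
    congr 1
    ext x
    rw [← Finset.prod_mul_distrib]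
    refine Finset.prod_congr rfl fun s _ => ?_
    have hz : (zSign (x (J s)) * zSign (x (K s))) ^ 2 = 1 := by
      rw [mul_pow, pow_two, pow_two, zSign_mul_self, zSign_mul_self, one_mul]
    push_cast
    linear_combination (ε * S * (zSign (x (J s)) * zSign (x (K s))) ^ 2) * Complex.I_sq -
      (ε * S) * hz
  have h2 := congrArg Matrix.trace h1
  rw [trace_pairDiagonal hJK hdis, h.2] at h2
  have h3 : (star G * (∑ i, c i • L i) * D).trace = ∑ i, c i * (star G * L i * D).trace := by
    simp [Finset.mul_sum, Finset.sum_mul, Matrix.trace_sum]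
  have h4 : (|C| + |S|) ^ Fintype.card σ * 2 ^ n ≤ (∑ i, ‖c i‖) * 2 ^ n := by
    calc (|C| + |S|) ^ Fintype.card σ * 2 ^ n
        = ‖((C - ε * S : ℝ) : ℂ) ^ Fintype.card σ * 2 ^ n‖ := by
          rw [norm_mul, norm_pow, norm_pow, Complex.norm_real, Real.norm_eq_abs, hCS]
          simp
      _ = ‖∑ i, c i * (star G * L i * D).trace‖ := by
          rw [← h3, h2, Finset.card_univ]
      _ ≤ ∑ i, ‖c i‖ * 2 ^ n := by
          refine (norm_sum_le _ _).trans (Finset.sum_le_sum fun i _ => ?_)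
          rw [norm_mul]
          exact mul_le_mul_of_nonneg_left (norm_trace_mul_pairDiagonal_le hJK hdis hε _
            (hG.star.mul (h.1 i).isFree)) (norm_nonneg _)
      _ = _ := by rw [Finset.sum_mul]
  exact le_of_mul_le_mul_right h4 (by positivity)

end GaussianFree

section CanonicalForm

/-! ### Rotations and the canonical form -/

/-- The ring homomorphism `ℂ × ℂ → M_ι(ℂ)` that sends `(u, v)` to the operator with eigenvalue `u`
on the `+1` eigenspace and `v` on the `-1` eigenspace of the involution `P`. -/
noncomputable def involutionHom {ι : Type} [Fintype ι] [DecidableEq ι] (P : Matrix ι ι ℂ)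
    (hP : P * P = 1) : ℂ × ℂ →+* Matrix ι ι ℂ where
  toFun w := ((w.1 + w.2) / 2) • 1 + ((w.1 - w.2) / 2) • P
  map_one' := by simp
  map_zero' := by simp
  map_add' w z := by
    simp only [Prod.fst_add, Prod.snd_add]
    module
  map_mul' w z := by
    simp only [Prod.fst_mul, Prod.snd_mul, add_mul, mul_add, smul_mul_smul_comm, hP, mul_one,
      one_mul]
    module

/-- The exponential of an involution, computed in the commutative algebra `ℂ × ℂ` of functions on
its spectrum. -/
theorem rot_eq {ι : Type} [Fintype ι] [DecidableEq ι] {P : Matrix ι ι ℂ} (hP : P * P = 1) (θ : ℝ) :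
    rot P θ = ((Real.cos (θ / 2) : ℝ) : ℂ) • (1 : Matrix ι ι ℂ) +
      (-(Complex.I * ((Real.sin (θ / 2) : ℝ) : ℂ))) • P := by
  -- any norm that induces the topology of the matrix algebra serves to apply `NormedSpace.map_exp`
  let _ : NormedRing (Matrix ι ι ℂ) := Matrix.linftyOpNormedRing
  have hc : Continuous (involutionHom P hP) := by
    change Continuous fun w : ℂ × ℂ => ((w.1 + w.2) / 2) • (1 : Matrix ι ι ℂ) +
      ((w.1 - w.2) / 2) • P
    fun_prop
  have h := NormedSpace.map_exp (involutionHom P hP) hc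
    (((-(Complex.I * (θ : ℂ) / 2)), (Complex.I * (θ : ℂ) / 2)) : ℂ × ℂ)
  have e : involutionHom P hP (((-(Complex.I * (θ : ℂ) / 2)), (Complex.I * (θ : ℂ) / 2))) =
      (-(Complex.I * (θ : ℂ) / 2)) • P := by
    change (_ / 2 : ℂ) • (1 : Matrix ι ι ℂ) + (_ / 2 : ℂ) • P = _
    module
  rw [e] at h
  refine h.symm.trans ?_
  change ((_ + _) / 2 : ℂ) • (1 : Matrix ι ι ℂ) + ((_ - _) / 2 : ℂ) • P = _
  rw [Prod.fst_exp, Prod.snd_exp, ← Complex.exp_eq_exp_ℂ]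
  have e1 : Complex.exp (Complex.I * (θ : ℂ) / 2) = ((Real.cos (θ / 2) : ℝ) : ℂ) +
      ((Real.sin (θ / 2) : ℝ) : ℂ) * Complex.I := by
    push_cast
    rw [← Complex.exp_mul_I]
    congr 1
    ring
  have e2 : Complex.exp (-(Complex.I * (θ : ℂ) / 2)) = ((Real.cos (θ / 2) : ℝ) : ℂ) -
      ((Real.sin (θ / 2) : ℝ) : ℂ) * Complex.I := by
    push_cast
    rw [Complex.cos_sub_sin_I]
    congr 1
    ring
  simp only [e1, e2]
  module

theorem rot_add {ι : Type} [Fintype ι] [DecidableEq ι] (P : Matrix ι ι ℂ) (θ η : ℝ) :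
    rot P (θ + η) = rot P θ * rot P η := by
  rw [rot, rot, rot, ← Matrix.exp_add_of_commute]
  · congr 1
    push_cast
    module
  · exact ((Commute.refl P).smul_left _).smul_right _

theorem rot_neg {ι : Type} [Fintype ι] [DecidableEq ι] (P : Matrix ι ι ℂ) (θ : ℝ) :
    rot (-P) θ = rot P (-θ) := by
  rw [rot, rot]
  congr 1
  push_cast
  module

theorem rot_mem_unitaryGroup {ι : Type} [Fintype ι] [DecidableEq ι] {P : Matrix ι ι ℂ}
    (hP : P * P = 1) (hP' : Pᴴ = P) (θ : ℝ) : rot P θ ∈ Matrix.unitaryGroup ι ℂ := by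
  have : star (rot P θ) = rot P (-θ) := by
    rw [rot_eq hP, rot_eq hP, Matrix.star_eq_conjTranspose]
    simp [hP', neg_div, - Complex.ofReal_cos, - Complex.ofReal_sin]
  rw [Matrix.mem_unitaryGroup_iff, this, ← rot_add, add_neg_cancel, rot]
  simp

theorem matchgate_add (A B C D : OneQubitOp) :
    matchgate A B + matchgate C D = matchgate (A + C) (B + D) := by
  ext x y
  simp only [matchgate, Matrix.add_apply]
  split_ifs <;> simp

theorem matchgate_smul (r : ℂ) (A B : OneQubitOp) :
    r • matchgate A B = matchgate (r • A) (r • B) := by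
  ext x y
  simp only [matchgate, Matrix.smul_apply]
  split_ifs <;> simp

theorem matchgate_injective {A B C D : OneQubitOp} (h : matchgate A B = matchgate C D) :
    A = C ∧ B = D := by
  constructor
  · ext i j
    have := congrFun (congrFun h (i, i)) (j, j)
    simpa [matchgate] using this
  · ext i j
    have := congrFun (congrFun h (i, i + 1)) (j, j + 1)
    simpa [matchgate] using this

theorem rot_matchgate {P Q : OneQubitOp} (hP : P * P = 1) (hQ : Q * Q = 1) (θ : ℝ) :
    rot (matchgate P Q) θ = matchgate (rot P θ) (rot Q θ) := by
  rw [rot_eq (by rw [matchgate_mul, hP, hQ, matchgate_one]), rot_eq hP, rot_eq hQ, ← matchgate_one,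
    matchgate_smul, matchgate_smul, matchgate_add]

theorem pauliX_kronecker : pauliX ⊗ₖ pauliX = matchgate pauliX pauliX := by
  ext ⟨x1, x2⟩ ⟨y1, y2⟩
  fin_cases x1 <;> fin_cases x2 <;> fin_cases y1 <;> fin_cases y2 <;> simp [matchgate, pauliX]

theorem pauliY_kronecker : pauliY ⊗ₖ pauliY = matchgate (-pauliX) pauliX := by
  ext ⟨x1, x2⟩ ⟨y1, y2⟩
  fin_cases x1 <;> fin_cases x2 <;> fin_cases y1 <;> fin_cases y2 <;>
  simp [matchgate, pauliX, pauliY]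

theorem pauliZ_kronecker : pauliZ ⊗ₖ pauliZ = matchgate 1 (-1) := by
  ext ⟨x1, x2⟩ ⟨y1, y2⟩
  fin_cases x1 <;> fin_cases x2 <;> fin_cases y1 <;> fin_cases y2 <;> simp [matchgate, pauliZ]

theorem pauliZ_mul_self : pauliZ * pauliZ = 1 := by
  ext i j
  fin_cases i <;> fin_cases j <;> simp [pauliZ]

theorem pauliZ_conjTranspose : pauliZᴴ = pauliZ := by
  ext i j
  fin_cases i <;> fin_cases j <;> simp [pauliZ]

theorem rot_pauliZ (θ : ℝ) : rot pauliZ θ =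
    !![Complex.exp (-(Complex.I * θ / 2)), 0; 0, Complex.exp (Complex.I * θ / 2)] := by
  have h : (-(Complex.I * (θ : ℂ) / 2)) • pauliZ =
      Matrix.diagonal ![-(Complex.I * θ / 2), Complex.I * θ / 2] := by
    ext i j
    fin_cases i <;> fin_cases j <;> simp [pauliZ]
  rw [rot, h, Matrix.exp_diagonal]
  ext i j
  fin_cases i <;> fin_cases j <;> simp [Pi.coe_exp, Complex.exp_eq_exp_ℂ]

theorem rot_pauliX (θ : ℝ) : rot pauliX θ =
    !![((Real.cos (θ / 2) : ℝ) : ℂ), -(Complex.I * ((Real.sin (θ / 2) : ℝ) : ℂ));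
      -(Complex.I * ((Real.sin (θ / 2) : ℝ) : ℂ)), ((Real.cos (θ / 2) : ℝ) : ℂ)] := by
  rw [rot_eq pauliX_mul_self]
  ext i j
  fin_cases i <;> fin_cases j <;> simp [pauliX]

theorem rot_pauliZ_kronecker (s t : ℝ) : rot pauliZ s ⊗ₖ rot pauliZ t =
    matchgate (rot pauliZ (s + t)) (rot pauliZ (s - t)) := by
  simp only [rot_pauliZ]
  ext ⟨x1, x2⟩ ⟨y1, y2⟩
  fin_cases x1 <;> fin_cases x2 <;> fin_cases y1 <;> fin_cases y2 <;>
  simp [matchgate, ← Complex.exp_add]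
  all_goals
    congr 1
    ring

theorem det_rot_pauliZ (θ : ℝ) : (rot pauliZ θ).det = 1 := by
  rw [rot_pauliZ, Matrix.det_fin_two_of, ← Complex.exp_add]
  simp

theorem det_rot_pauliX (θ : ℝ) : (rot pauliX θ).det = 1 := by
  rw [rot_pauliX, Matrix.det_fin_two_of]
  have h : ((Real.cos (θ / 2) : ℝ) : ℂ) ^ 2 + ((Real.sin (θ / 2) : ℝ) : ℂ) ^ 2 = 1 := by
    push_cast
    exact Complex.cos_sq_add_sin_sq _
  linear_combination h - ((Real.sin (θ / 2) : ℝ) : ℂ) ^ 2 * Complex.I_sq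

/-- The one-qubit operator `e^{iφ} R_Z(x) R_X(y) R_Z(z)`. -/
noncomputable def eulerOp (φ x y z : ℝ) : OneQubitOp :=
  Complex.exp (Complex.I * φ) • (rot pauliZ x * rot pauliX y * rot pauliZ z)

theorem exp_I_mul_mul_star (φ : ℝ) :
    Complex.exp (Complex.I * φ) * star (Complex.exp (Complex.I * φ)) = 1 := by
  rw [RCLike.star_def, ← Complex.exp_conj, ← Complex.exp_add]
  simp

theorem eulerOp_mem_unitaryGroup (φ x y z : ℝ) :
    eulerOp φ x y z ∈ Matrix.unitaryGroup (Fin 2) ℂ := by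
  have h := mul_mem (mul_mem (rot_mem_unitaryGroup pauliZ_mul_self pauliZ_conjTranspose x)
    (rot_mem_unitaryGroup pauliX_mul_self pauliX_conjTranspose y))
    (rot_mem_unitaryGroup pauliZ_mul_self pauliZ_conjTranspose z)
  rw [Matrix.mem_unitaryGroup_iff] at h ⊢
  rw [eulerOp, star_smul, smul_mul_smul_comm, h, exp_I_mul_mul_star, one_smul]

theorem det_eulerOp (φ x y z : ℝ) : (eulerOp φ x y z).det = Complex.exp (Complex.I * φ) ^ 2 := by
  simp [eulerOp, Matrix.det_smul, Matrix.det_mul, det_rot_pauliX, det_rot_pauliZ]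

/-- The Euler decomposition of `U(2)`. -/
theorem exists_eulerOp {A : OneQubitOp} (hA : A ∈ Matrix.unitaryGroup (Fin 2) ℂ) :
    ∃ φ x y z : ℝ, A = eulerOp φ x y z := by
  obtain ⟨h1, h2, h3, h4⟩ := unitary_fin_two hA
  have hd : ‖A.det‖ = 1 := by
    have := congrArg norm h3
    rw [norm_mul, norm_star, norm_one] at this
    nlinarith [norm_nonneg A.det]
  -- `(u, v)` is the first row of the element `e⁻¹ A` of `SU(2)`
  set α : ℝ := A.det.arg / 2 with hα
  set e : ℂ := Complex.exp (Complex.I * α) with he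
  have hee : e * star e = 1 := exp_I_mul_mul_star α
  have hdet : A.det = e ^ 2 := by
    rw [← Complex.norm_mul_exp_arg_mul_I A.det, hd, he, ← Complex.exp_nat_mul]
    simp only [Complex.ofReal_one, one_mul]
    congr 1
    rw [hα]
    push_cast
    ring
  set u : ℂ := A 0 0 * star e with hu
  set v : ℂ := A 0 1 * star e with hv
  have huv : ‖u‖ ^ 2 + ‖v‖ ^ 2 = 1 := by
    have : ((‖u‖ ^ 2 + ‖v‖ ^ 2 : ℝ) : ℂ) = 1 := by
      push_cast
      rw [← Complex.mul_conj', ← Complex.mul_conj', ← h4, hu, hv]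
      simp only [RCLike.star_def, map_mul, Complex.conj_conj] at hee ⊢
      linear_combination (A 0 0 * (starRingEnd ℂ) (A 0 0) + A 0 1 * (starRingEnd ℂ) (A 0 1)) * hee
    exact_mod_cast this
  have hn : ‖(⟨‖u‖, ‖v‖⟩ : ℂ)‖ = 1 := by
    rw [Complex.norm_def, Complex.normSq_mk, ← pow_two, ← pow_two, huv, Real.sqrt_one]
  set η := Complex.arg ⟨‖u‖, ‖v‖⟩ with hη
  have hcos : Real.cos η = ‖u‖ := by
    have := Complex.norm_mul_cos_arg (⟨‖u‖, ‖v‖⟩ : ℂ)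
    rwa [hn, one_mul] at this
  have hsin : Real.sin η = ‖v‖ := by
    have := Complex.norm_mul_sin_arg (⟨‖u‖, ‖v‖⟩ : ℂ)
    rwa [hn, one_mul] at this
  have hu' := Complex.norm_mul_exp_arg_mul_I u
  have hv' := Complex.norm_mul_exp_arg_mul_I v
  have hA0 : A 0 0 = e * u := by rw [hu]; linear_combination -(A 0 0) * hee
  have hA1 : A 0 1 = e * v := by rw [hv]; linear_combination -(A 0 1) * hee
  have hA2 : A 1 0 = -(e * star v) := by
    rw [h1, hdet, hA1, star_mul]
    linear_combination -(e * star v) * hee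
  have hA3 : A 1 1 = e * star u := by
    rw [h2, hdet, hA0, star_mul]
    linear_combination (e * star u) * hee
  have hus : star u = ‖u‖ * Complex.exp (-(u.arg * Complex.I)) := by
    conv_lhs => rw [← hu']
    rw [RCLike.star_def, map_mul, ← Complex.exp_conj]
    simp
  have hvs : star v = ‖v‖ * Complex.exp (-(v.arg * Complex.I)) := by
    conv_lhs => rw [← hv']
    rw [RCLike.star_def, map_mul, ← Complex.exp_conj]
    simp
  have hI : Complex.exp (Complex.I * (Real.pi / 2 : ℝ)) = Complex.I := by
    rw [mul_comm]; push_cast; exact Complex.exp_pi_div_two_mul_I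
  have hI' : Complex.exp (-(Complex.I * (Real.pi / 2 : ℝ))) = -Complex.I := by
    rw [Complex.exp_neg, hI, Complex.inv_I]
  -- the arguments of `u` and `i v` determine the sum and the difference of the two `Z` angles
  refine ⟨α, -u.arg - v.arg - Real.pi / 2, 2 * η, -u.arg + v.arg + Real.pi / 2, ?_⟩
  rw [eulerOp, rot_pauliZ, rot_pauliX, rot_pauliZ, mul_div_cancel_left₀ _ two_ne_zero, hcos, hsin]
  ext i j
  fin_cases i <;> fin_cases j
  · simp [- Complex.ofReal_sub, - Complex.ofReal_add, Matrix.mul_apply, Fin.sum_univ_two]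
    rw [hA0, mul_right_comm, ← Complex.exp_add]
    conv_lhs => rw [← hu']
    rw [mul_comm (‖u‖ : ℂ)]
    congr 3
    push_cast
    ring
  · simp [- Complex.ofReal_sub, - Complex.ofReal_add, Matrix.mul_apply, Fin.sum_univ_two]
    rw [hA1]
    conv_lhs => rw [← hv']
    have : Complex.exp (v.arg * Complex.I) = - (Complex.I *
      (Complex.exp (-(Complex.I * ((-u.arg - v.arg - Real.pi / 2 : ℝ) : ℂ) / 2)) *
        Complex.exp (Complex.I * ((-u.arg + v.arg + Real.pi / 2 : ℝ) : ℂ) / 2))) := by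
      rw [← Complex.exp_add]
      have : (-(Complex.I * ((-u.arg - v.arg - Real.pi / 2 : ℝ) : ℂ) / 2)) +
        (Complex.I * ((-u.arg + v.arg + Real.pi / 2 : ℝ) : ℂ) / 2) = v.arg * Complex.I +
          Complex.I * (Real.pi / 2 : ℝ) := by
        push_cast
        ring
      rw [this, Complex.exp_add, hI]
      linear_combination Complex.exp (v.arg * Complex.I) * Complex.I_sq
    rw [this]
    ring
  · simp [- Complex.ofReal_sub, - Complex.ofReal_add, Matrix.mul_apply, Fin.sum_univ_two]
    rw [hA2, hvs]
    have : Complex.exp (-(v.arg * Complex.I)) = Complex.I *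
      (Complex.exp (Complex.I * ((-u.arg - v.arg - Real.pi / 2 : ℝ) : ℂ) / 2) *
        Complex.exp (-(Complex.I * ((-u.arg + v.arg + Real.pi / 2 : ℝ) : ℂ) / 2))) := by
      rw [← Complex.exp_add]
      have : (Complex.I * ((-u.arg - v.arg - Real.pi / 2 : ℝ) : ℂ) / 2) +
        (-(Complex.I * ((-u.arg + v.arg + Real.pi / 2 : ℝ) : ℂ) / 2)) = -(v.arg * Complex.I) +
          -(Complex.I * (Real.pi / 2 : ℝ)) := by
        push_cast
        ring
      rw [this, Complex.exp_add, hI']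
      linear_combination Complex.exp (-(v.arg * Complex.I)) * Complex.I_sq
    rw [this]
    ring
  · simp [- Complex.ofReal_sub, - Complex.ofReal_add, Matrix.mul_apply, Fin.sum_univ_two]
    rw [hA3, mul_right_comm, ← Complex.exp_add, hus]
    rw [mul_comm (‖u‖ : ℂ)]
    congr 3
    push_cast
    ring

/-- A two-qubit fermionic gate is block diagonal with respect to the parity. -/
theorem IsFermionicGate.exists_eq_matchgate {U : TwoQubitOp} (hU : IsFermionicGate U) :
    ∃ A ∈ Matrix.unitaryGroup (Fin 2) ℂ, ∃ B ∈ Matrix.unitaryGroup (Fin 2) ℂ,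
      U = matchgate A B := by
  obtain ⟨h1, h2⟩ := hU
  have h : U = matchgate (Matrix.of fun i j => U (i, i) (j, j))
      (Matrix.of fun i j => U (i, i + 1) (j, j + 1)) := by
    rw [commute_iff_eq, pauliZ_eq_diagonal, Matrix.diagonal_kronecker_diagonal] at h2
    ext ⟨x1, x2⟩ ⟨y1, y2⟩
    have := congrFun (congrFun h2 (x1, x2)) (y1, y2)
    rw [Matrix.mul_diagonal, Matrix.diagonal_mul] at this
    fin_cases x1 <;> fin_cases x2 <;> fin_cases y1 <;> fin_cases y2 <;>
    simp_all [matchgate, zSign, eq_neg_iff_add_eq_zero, neg_eq_iff_add_eq_zero]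
  generalize (Matrix.of fun i j => U (i, i) (j, j)) = A at h
  generalize (Matrix.of fun i j => U (i, i + 1) (j, j + 1)) = B at h
  rw [Matrix.mem_unitaryGroup_iff, Matrix.star_eq_conjTranspose, h, matchgate_conjTranspose,
    matchgate_mul, ← matchgate_one] at h1
  obtain ⟨hA, hB⟩ := matchgate_injective h1
  exact ⟨A, Matrix.mem_unitaryGroup_iff.2 hA, B, Matrix.mem_unitaryGroup_iff.2 hB, h⟩

/-- The block on the even subspace of the gate with angles `p`, with `c = 0`. -/
noncomputable def evenBlock (p : Angles) : OneQubitOp :=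
  eulerOp p.φ (p.t₁ + p.t₂) (p.a - p.b) (p.t₃ + p.t₄)

/-- The block on the odd subspace of the gate with angles `p`, with `c = 0`. -/
noncomputable def oddBlock (p : Angles) : OneQubitOp :=
  eulerOp p.φ (p.t₁ - p.t₂) (p.a + p.b) (p.t₃ - p.t₄)

theorem dress_matchgate_smul (p : Angles) (u v : ℂ) :
    dress p (matchgate (u • 1) (v • 1)) = matchgate (u • evenBlock p) (v • oddBlock p) := by
  rw [dress, rot_pauliZ_kronecker, rot_pauliZ_kronecker, pauliX_kronecker, pauliY_kronecker,
    rot_matchgate pauliX_mul_self pauliX_mul_self, rot_matchgate (by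
      rw [neg_mul_neg, pauliX_mul_self]) pauliX_mul_self, matchgate_mul, matchgate_mul,
    matchgate_mul, matchgate_mul, matchgate_smul, rot_neg, mul_assoc (rot pauliZ (p.t₁ + p.t₂)),
    mul_assoc (rot pauliZ (p.t₁ - p.t₂)), ← rot_add, ← rot_add, ← sub_eq_add_neg]
  simp only [evenBlock, oddBlock, eulerOp, smul_mul_assoc, mul_smul_comm, mul_one]
  rw [smul_comm _ u, smul_comm _ v]

theorem dress_one (p : Angles) : dress p 1 = matchgate (evenBlock p) (oddBlock p) := by
  rw [← matchgate_one]
  simpa using dress_matchgate_smul p 1 1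

theorem dress_zz (p : Angles) :
    dress p (pauliZ ⊗ₖ pauliZ) = matchgate (evenBlock p) (-oddBlock p) := by
  rw [pauliZ_kronecker]
  simpa using dress_matchgate_smul p 1 (-1)

theorem zz_mul_self : (pauliZ ⊗ₖ pauliZ) * (pauliZ ⊗ₖ pauliZ) = (1 : TwoQubitOp) := by
  rw [pauliZ_kronecker, matchgate_mul]
  simp [matchgate_one]

theorem rot_zz (c : ℝ) : rot (pauliZ ⊗ₖ pauliZ) c =
    matchgate (Complex.exp (-(Complex.I * c / 2)) • 1) (Complex.exp (Complex.I * c / 2) • 1) := by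
  rw [pauliZ_kronecker, rot_matchgate (one_mul 1) (by simp)]
  congr 1
  · rw [rot, ← Matrix.diagonal_one, ← Matrix.diagonal_smul, Matrix.exp_diagonal,
      ← Matrix.diagonal_smul]
    congr 1
    ext i
    simp [Pi.coe_exp, Complex.exp_eq_exp_ℂ]
  · rw [rot, smul_neg, ← neg_smul, ← Matrix.diagonal_one, ← Matrix.diagonal_smul,
      Matrix.exp_diagonal, ← Matrix.diagonal_smul]
    congr 1
    ext i
    simp [Pi.coe_exp, Complex.exp_eq_exp_ℂ]

theorem canonicalGate_eq_matchgate (p : Angles) : canonicalGate p =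
    matchgate (Complex.exp (-(Complex.I * p.c / 2)) • evenBlock p)
      (Complex.exp (Complex.I * p.c / 2) • oddBlock p) := by
  rw [canonicalGate, rot_zz, dress_matchgate_smul]

theorem canonicalGate_eq_sum (p : Angles) :
    canonicalGate p = ∑ i, rzzCoeff p.c i • dress p (rzzTerm i) := by
  rw [canonicalGate, rot_eq zz_mul_self]
  simp only [Fin.sum_univ_two, rzzCoeff, rzzTerm, dress, Matrix.cons_val_zero, Matrix.cons_val_one,
    mul_add, add_mul, mul_smul_comm, smul_mul_assoc, smul_add]
  congr 1
  · rw [smul_comm]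
  · rw [smul_comm]

theorem canonicalGate_eq_mul (p : Angles) :
    canonicalGate p = dress p 1 * rot (pauliZ ⊗ₖ pauliZ) p.c := by
  rw [canonicalGate_eq_matchgate, dress_one, rot_zz, matchgate_mul]
  simp

/-- The existence of the canonical form: the Euler decompositions of the two parity blocks. -/
theorem IsFermionicGate.exists_eq_canonicalGate {U : TwoQubitOp} (hU : IsFermionicGate U) :
    ∃ p : Angles, U = canonicalGate p := by
  obtain ⟨A, hA, B, hB, rfl⟩ := hU.exists_eq_matchgate
  obtain ⟨φ, x, y, z, rfl⟩ := exists_eulerOp hA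
  obtain ⟨φ', x', y', z', rfl⟩ := exists_eulerOp hB
  -- the even block has the angles `t₁ + t₂`, `a - b`, `t₃ + t₄` and the phase `φ - c / 2`, the odd
  -- block has `t₁ - t₂`, `a + b`, `t₃ - t₄` and `φ + c / 2`
  refine ⟨⟨(φ + φ') / 2, (x + x') / 2, (x - x') / 2, (z + z') / 2, (z - z') / 2, (y' + y) / 2,
    (y' - y) / 2, φ' - φ⟩, ?_⟩
  rw [canonicalGate_eq_matchgate]
  simp only [evenBlock, oddBlock, eulerOp, smul_smul, ← Complex.exp_add]
  congr 1
  · congr 2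
    · push_cast; ring
    · congr 2
      · ring_nf
      · ring_nf
    · ring_nf
  · congr 2
    · push_cast; ring
    · congr 2
      · ring_nf
      · ring_nf
    · ring_nf

end CanonicalForm

section GaussianGates

/-! ### Gaussian unitaries among the embedded gates -/

variable {n : ℕ}

theorem IsGaussian.mul {K L : QubitOp n} (hK : IsGaussian K) (hL : IsGaussian L) :
    IsGaussian (K * L) := by
  obtain ⟨g, hg, rfl⟩ := hK
  obtain ⟨h, hh, rfl⟩ := hL
  exact ⟨g * h, mul_mem hg hh, rfl⟩

theorem isGaussian_onPair_of_succ {j k : Fin n} (hjk : (j : ℕ) + 1 = k) {A B : OneQubitOp}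
    (hA : A ∈ Matrix.unitaryGroup (Fin 2) ℂ) (hB : B ∈ Matrix.unitaryGroup (Fin 2) ℂ)
    (hAB : A.det = B.det) : IsGaussian (onPair j k (matchgate A B)) := by
  have hne : j ≠ k := fun h => by rw [h] at hjk; omega
  exact ⟨⟨_, onPair_mem_unitaryGroup hne (matchgate_mem_unitaryGroup hA hB)⟩,
    Subgroup.subset_closure (Or.inl ⟨j, k, hjk, A, hA, B, hB, hAB, rfl⟩), rfl⟩

theorem pauliX_mem_unitaryGroup : pauliX ∈ Matrix.unitaryGroup (Fin 2) ℂ := by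
  rw [Matrix.mem_unitaryGroup_iff, Matrix.star_eq_conjTranspose, pauliX_conjTranspose,
    pauliX_mul_self]

/-- Exchanging the two qubits of a matchgate conjugates its odd block by `X`. -/
theorem onPair_matchgate_swap (j k : Fin n) (A B : OneQubitOp) :
    onPair j k (matchgate A B) = onPair k j (matchgate A (pauliX * B * pauliX)) := by
  have h : ∀ x1 x2 y1 y2, matchgate A B (x1, x2) (y1, y2) =
      matchgate A (pauliX * B * pauliX) (x2, x1) (y2, y1) := by
    intro x1 x2 y1 y2
    fin_cases x1 <;> fin_cases x2 <;> fin_cases y1 <;> fin_cases y2 <;>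
    simp [matchgate, pauliX, Matrix.mul_apply, Matrix.vecMul, dotProduct, Fin.sum_univ_two]
  ext x y
  simp only [onPair, h]
  congr 1
  exact propext ⟨fun h l h1 h2 => h l h2 h1, fun h l h1 h2 => h l h2 h1⟩

theorem isGaussian_onPair_of_adjacent {j k : Fin n}
    (hjk : (j : ℕ) + 1 = k ∨ (k : ℕ) + 1 = j) {A B : OneQubitOp}
    (hA : A ∈ Matrix.unitaryGroup (Fin 2) ℂ) (hB : B ∈ Matrix.unitaryGroup (Fin 2) ℂ)
    (hAB : A.det = B.det) : IsGaussian (onPair j k (matchgate A B)) := by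
  rcases hjk with hjk | hjk
  · exact isGaussian_onPair_of_succ hjk hA hB hAB
  · rw [onPair_matchgate_swap]
    refine isGaussian_onPair_of_succ hjk hA
      (mul_mem (mul_mem pauliX_mem_unitaryGroup hB) pauliX_mem_unitaryGroup) ?_
    rw [hAB, mul_assoc, Matrix.det_mul, Matrix.det_mul, mul_left_comm, ← Matrix.det_mul,
      pauliX_mul_self, Matrix.det_one, mul_one]

theorem diagonal_mem_unitaryGroup {u v : ℂ} (hu : u * star u = 1) (hv : v * star v = 1) :
    Matrix.diagonal ![u, v] ∈ Matrix.unitaryGroup (Fin 2) ℂ := by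
  rw [Matrix.mem_unitaryGroup_iff, Matrix.star_eq_conjTranspose, Matrix.diagonal_conjTranspose,
    Matrix.diagonal_mul_diagonal, ← Matrix.diagonal_one]
  congr 1
  ext i
  fin_cases i
  exacts [hu, hv]

/-- If there are at least two qubits, then diagonal one-qubit gates are Gaussian: together with the
identity of a neighbouring qubit they form a matchgate. -/
theorem isGaussian_onQubit_diagonal {j k : Fin n} (hjk : j ≠ k) {u v : ℂ} (hu : u * star u = 1)
    (hv : v * star v = 1) : IsGaussian (onQubit j (Matrix.diagonal ![u, v])) := by
  have hn : (j : ℕ) ≠ k := fun h => hjk (Fin.ext h)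
  by_cases hj : (j : ℕ) + 1 < n
  · have e : matchgate (Matrix.diagonal ![u, v]) (Matrix.diagonal ![u, v]) =
        Matrix.diagonal ![u, v] ⊗ₖ (1 : OneQubitOp) := by
      ext ⟨x1, x2⟩ ⟨y1, y2⟩
      fin_cases x1 <;> fin_cases x2 <;> fin_cases y1 <;> fin_cases y2 <;> simp [matchgate]
    have h := isGaussian_onPair_of_succ (j := j) (k := ⟨j + 1, hj⟩) rfl
      (diagonal_mem_unitaryGroup hu hv) (diagonal_mem_unitaryGroup hu hv) rfl
    rwa [e, onPair_kronecker (by simp [Fin.ext_iff]), onQubit_one, mul_one] at h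
  -- the last qubit has no right neighbour, but a left one because there are two qubits
  · have e : matchgate (Matrix.diagonal ![u, v]) (Matrix.diagonal ![v, u]) =
        (1 : OneQubitOp) ⊗ₖ Matrix.diagonal ![u, v] := by
      ext ⟨x1, x2⟩ ⟨y1, y2⟩
      fin_cases x1 <;> fin_cases x2 <;> fin_cases y1 <;> fin_cases y2 <;> simp [matchgate]
    have hj' : (j : ℕ) - 1 < n := by omega
    have h0 : (j : ℕ) - 1 + 1 = j := by omega
    have h := isGaussian_onPair_of_succ (j := ⟨j - 1, hj'⟩) (k := j) h0
      (diagonal_mem_unitaryGroup hu hv) (diagonal_mem_unitaryGroup hv hu)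
      (by simp [Matrix.det_diagonal, Fin.prod_univ_two, mul_comm])
    rwa [e, onPair_kronecker (by simp [Fin.ext_iff]; omega), onQubit_one, one_mul] at h

/-- A diagonal matchgate is a product of two diagonal one-qubit gates, hence Gaussian on any pair of
qubits. -/
theorem isGaussian_onPair_of_isDiag {j k : Fin n} (hjk : j ≠ k) {A B : OneQubitOp}
    (hA : A ∈ Matrix.unitaryGroup (Fin 2) ℂ) (hB : B ∈ Matrix.unitaryGroup (Fin 2) ℂ)
    (hAB : A.det = B.det) (hA' : A.IsDiag) (hB' : B.IsDiag) :
    IsGaussian (onPair j k (matchgate A B)) := by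
  have h01 : (0 : Fin 2) ≠ 1 := by decide
  obtain ⟨-, -, -, hA0⟩ := unitary_fin_two hA
  obtain ⟨-, -, -, hB0⟩ := unitary_fin_two hB
  rw [hA' h01, zero_mul, add_zero] at hA0
  rw [hB' h01, zero_mul, add_zero] at hB0
  have hB1 : B 1 1 * star (B 1 1) = 1 := by
    have := congrFun (congrFun (Matrix.mem_unitaryGroup_iff.1 hB) 1) 1
    simpa [Matrix.mul_apply, Fin.sum_univ_two, hB' h01.symm] using this
  rw [Matrix.det_fin_two, Matrix.det_fin_two, hA' h01, hB' h01, zero_mul, sub_zero, zero_mul,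
    sub_zero] at hAB
  have hA1 : A 1 1 = B 1 1 * star (A 0 0) * B 0 0 := by
    linear_combination (star (A 0 0)) * hAB - (A 1 1) * hA0
  have e : matchgate A B = Matrix.diagonal ![1, B 1 1 * star (A 0 0)] ⊗ₖ
      Matrix.diagonal ![A 0 0, B 0 0] := by
    have hA'' : A = Matrix.diagonal ![A 0 0, B 1 1 * star (A 0 0) * B 0 0] := by
      rw [← hA1]
      ext i i'
      fin_cases i <;> fin_cases i' <;> simp [hA' h01, hA' h01.symm]
    have hB'' : B = Matrix.diagonal ![B 0 0, B 1 1] := by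
      ext i i'
      fin_cases i <;> fin_cases i' <;> simp [hB' h01, hB' h01.symm]
    have h3 : B 1 1 * star (A 0 0) * A 0 0 = B 1 1 := by linear_combination (B 1 1) * hA0
    generalize A 0 0 = a at *
    generalize B 0 0 = b at *
    generalize B 1 1 = d at *
    rw [hA'', hB'', Matrix.diagonal_kronecker_diagonal]
    ext ⟨x1, x2⟩ ⟨y1, y2⟩
    fin_cases x1 <;> fin_cases x2 <;> fin_cases y1 <;> fin_cases y2 <;> simp [matchgate]
    exact h3.symm
  rw [e, onPair_kronecker hjk]
  refine (isGaussian_onQubit_diagonal hjk (by simp) ?_).mul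
    (isGaussian_onQubit_diagonal hjk.symm hA0 hB0)
  rw [star_mul, star_star]
  linear_combination (B 1 1 * star (B 1 1)) * hA0 + hB1

theorem det_evenBlock (p : Angles) : (evenBlock p).det = (oddBlock p).det := by
  rw [evenBlock, oddBlock, det_eulerOp, det_eulerOp]

/-- The two operators of the decomposition of the canonical form are Gaussian. -/
theorem isGaussian_onPair_dress {j k : Fin n} (hjk : j ≠ k) {p : Angles}
    (h : ((j : ℕ) + 1 = k ∨ (k : ℕ) + 1 = j) ∨ (canonicalGate p).IsDiag) (i : Fin 2) :
    IsGaussian (onPair j k (dress p (rzzTerm i))) := by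
  have hA : evenBlock p ∈ Matrix.unitaryGroup (Fin 2) ℂ := eulerOp_mem_unitaryGroup _ _ _ _
  have hB : oddBlock p ∈ Matrix.unitaryGroup (Fin 2) ℂ := eulerOp_mem_unitaryGroup _ _ _ _
  have hneg : ∀ {B : OneQubitOp}, B ∈ Matrix.unitaryGroup (Fin 2) ℂ →
      -B ∈ Matrix.unitaryGroup (Fin 2) ℂ := by
    intro B hB
    rw [Matrix.mem_unitaryGroup_iff] at hB ⊢
    rw [star_neg, neg_mul_neg, hB]
  have hdet : (evenBlock p).det = (-oddBlock p).det := by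
    rw [det_evenBlock, Matrix.det_neg]
    simp
  have key : ∀ {B : OneQubitOp}, B ∈ Matrix.unitaryGroup (Fin 2) ℂ → (evenBlock p).det = B.det →
      (B = oddBlock p ∨ B = -oddBlock p) → IsGaussian (onPair j k (matchgate (evenBlock p) B)) := by
    intro B hB' hd hBo
    rcases h with h | h
    · exact isGaussian_onPair_of_adjacent h hA hB' hd
    · rw [canonicalGate_eq_matchgate] at h
      have h1 : (evenBlock p).IsDiag := by
        intro a b hab
        have := h (i := (a, a)) (j := (b, b)) (by simpa using hab)
        simpa [matchgate] using this
      have h2 : (oddBlock p).IsDiag := by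
        intro a b hab
        have := h (i := (a, a + 1)) (j := (b, b + 1)) (by simpa using hab)
        simpa [matchgate] using this
      refine isGaussian_onPair_of_isDiag hjk hA hB' hd h1 ?_
      rcases hBo with rfl | rfl
      · exact h2
      · exact h2.neg
  fin_cases i
  · change IsGaussian (onPair j k (dress p 1))
    rw [dress_one]
    exact key hB (det_evenBlock p) (Or.inl rfl)
  · change IsGaussian (onPair j k (dress p (pauliZ ⊗ₖ pauliZ)))
    rw [dress_zz]
    exact key (hneg hB) hdet (Or.inr rfl)

end GaussianGates

section BlockTensor

/-! ### Tensor products of Gaussian unitaries -/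

variable {n t : ℕ}

/-- A bit string of length `t * n` as a family of `t` bit strings of length `n`. -/
def blockEquiv (n t : ℕ) : (Fin (t * n) → Fin 2) ≃ (Fin t → Fin n → Fin 2) :=
  (Equiv.arrowCongr finProdFinEquiv.symm (Equiv.refl _)).trans (Equiv.curry _ _ _)

theorem blockTensor_apply (V : Fin t → QubitOp n) (x y : Fin (t * n) → Fin 2) :
    blockTensor V x y = ∏ s, V s (blockEquiv n t x s) (blockEquiv n t y s) := rfl

theorem blockTensor_mul (V W : Fin t → QubitOp n) :
    blockTensor V * blockTensor W = blockTensor fun s => V s * W s := by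
  ext x y
  simp only [Matrix.mul_apply, blockTensor_apply, ← Finset.prod_mul_distrib]
  rw [Finset.prod_univ_sum, Fintype.piFinset_univ]
  exact Fintype.sum_equiv (blockEquiv n t) _ _ fun z => rfl

theorem blockTensor_diagonal (d : Fin t → (Fin n → Fin 2) → ℂ) :
    blockTensor (fun s => Matrix.diagonal (d s)) =
      Matrix.diagonal fun x => ∏ s, d s (blockEquiv n t x s) := by
  ext x y
  rw [blockTensor_apply]
  by_cases h : x = y
  · subst h; simp
  · rw [Matrix.diagonal_apply_ne _ h]
    obtain ⟨s, hs⟩ := Function.ne_iff.1 fun h' => h ((blockEquiv n t).injective h')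
    exact Finset.prod_eq_zero (Finset.mem_univ s) (Matrix.diagonal_apply_ne _ hs)

theorem blockTensor_one : blockTensor (fun _ : Fin t => (1 : QubitOp n)) = 1 := by
  simp only [← Matrix.diagonal_one]
  rw [blockTensor_diagonal]
  simp

theorem blockTensor_conjTranspose (V : Fin t → QubitOp n) :
    (blockTensor V)ᴴ = blockTensor fun s => (V s)ᴴ := by
  ext x y
  simp [blockTensor_apply, Matrix.conjTranspose_apply]

theorem blockTensor_sum {ι : Type} [Fintype ι] (c : Fin t → ι → ℂ) (K : ι → QubitOp n) :
    blockTensor (fun s => ∑ i, c s i • K i) =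
      ∑ i : Fin t → ι, (∏ s, c s (i s)) • blockTensor fun s => K (i s) := by
  classical
  ext x y
  simp only [blockTensor_apply, Matrix.sum_apply, Matrix.smul_apply, smul_eq_mul,
    ← Finset.prod_mul_distrib]
  rw [Finset.prod_univ_sum, Fintype.piFinset_univ]

/-- The tensor product as a homomorphism of unitary groups. -/
def blockTensorHom (n t : ℕ) : (Fin t → QubitUnitary n) →* QubitUnitary (t * n) where
  toFun V := ⟨blockTensor fun s => (V s : QubitOp n), by
    rw [Matrix.mem_unitaryGroup_iff, Matrix.star_eq_conjTranspose, blockTensor_conjTranspose,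
      blockTensor_mul, ← blockTensor_one]
    congr 1
    ext1 s
    exact Matrix.mem_unitaryGroup_iff.1 (V s).2⟩
  map_one' := Subtype.ext blockTensor_one
  map_mul' V W := Subtype.ext (blockTensor_mul _ _).symm

theorem blockTensor_mulSingle_onPair (s : Fin t) (j k : Fin n) (M : TwoQubitOp) :
    blockTensor (Pi.mulSingle s (onPair j k M)) =
      onPair (finProdFinEquiv (s, j)) (finProdFinEquiv (s, k)) M := by
  ext x y
  have h : (∀ l, l ≠ finProdFinEquiv (s, j) → l ≠ finProdFinEquiv (s, k) → x l = y l) ↔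
      (∀ s', s' ≠ s → blockEquiv n t x s' = blockEquiv n t y s') ∧
        ∀ l, l ≠ j → l ≠ k → blockEquiv n t x s l = blockEquiv n t y s l := by
    constructor
    · intro h
      refine ⟨fun s' hs' => funext fun l => h _ ?_ ?_, fun l h1 h2 => h _ ?_ ?_⟩ <;>
      simp_all
    · rintro ⟨h1, h2⟩ l
      obtain ⟨⟨s', l⟩, rfl⟩ := finProdFinEquiv.surjective l
      intro h3 h4
      by_cases hs : s' = s
      · subst hs
        exact h2 l (by simpa using h3) (by simpa using h4)
      · exact congrFun (h1 s' hs) l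
  rw [blockTensor_apply, onPair, ← Finset.mul_prod_erase _ _ (Finset.mem_univ s),
    Pi.mulSingle_eq_same, Finset.prod_congr rfl fun s' hs' => by
      rw [Pi.mulSingle_eq_of_ne (Finset.ne_of_mem_erase hs'), Matrix.one_apply]]
  simp only [h, ite_and, onPair]
  by_cases h1 : ∀ s', s' ≠ s → blockEquiv n t x s' = blockEquiv n t y s'
  · rw [if_pos h1, Finset.prod_eq_one fun s' hs' => if_pos (h1 s' (Finset.ne_of_mem_erase hs')),
      mul_one]
    rfl
  · rw [if_neg h1]
    push Not at h1
    obtain ⟨s', h2, h3⟩ := h1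
    rw [Finset.prod_eq_zero (Finset.mem_erase.2 ⟨h2, Finset.mem_univ _⟩) (if_neg h3), mul_zero]

theorem blockTensor_mulSingle_onQubit (s : Fin t) (j : Fin n) (A : OneQubitOp) :
    blockTensor (Pi.mulSingle s (onQubit j A)) = onQubit (finProdFinEquiv (s, j)) A := by
  ext x y
  have h : (∀ l, l ≠ finProdFinEquiv (s, j) → x l = y l) ↔
      (∀ s', s' ≠ s → blockEquiv n t x s' = blockEquiv n t y s') ∧
        ∀ l, l ≠ j → blockEquiv n t x s l = blockEquiv n t y s l := by
    constructor
    · intro h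
      refine ⟨fun s' hs' => funext fun l => h _ ?_, fun l h1 => h _ ?_⟩ <;>
      simp_all
    · rintro ⟨h1, h2⟩ l
      obtain ⟨⟨s', l⟩, rfl⟩ := finProdFinEquiv.surjective l
      intro h3
      by_cases hs : s' = s
      · subst hs
        exact h2 l (by simpa using h3)
      · exact congrFun (h1 s' hs) l
  rw [blockTensor_apply, onQubit, ← Finset.mul_prod_erase _ _ (Finset.mem_univ s),
    Pi.mulSingle_eq_same, Finset.prod_congr rfl fun s' hs' => by
      rw [Pi.mulSingle_eq_of_ne (Finset.ne_of_mem_erase hs'), Matrix.one_apply]]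
  simp only [h, ite_and, onQubit]
  by_cases h1 : ∀ s', s' ≠ s → blockEquiv n t x s' = blockEquiv n t y s'
  · rw [if_pos h1, Finset.prod_eq_one fun s' hs' => if_pos (h1 s' (Finset.ne_of_mem_erase hs')),
      mul_one]
    rfl
  · rw [if_neg h1]
    push Not at h1
    obtain ⟨s', h2, h3⟩ := h1
    rw [Finset.prod_eq_zero (Finset.mem_erase.2 ⟨h2, Finset.mem_univ _⟩) (if_neg h3), mul_zero]

theorem coe_blockTensorHom_mulSingle (s : Fin t) (g : QubitUnitary n) :
    (blockTensorHom n t (Pi.mulSingle s g) : QubitOp (t * n)) =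
      blockTensor (Pi.mulSingle s (g : QubitOp n)) := by
  change blockTensor (fun s' => ((Pi.mulSingle s g : Fin t → QubitUnitary n) s' : QubitOp n)) = _
  congr 1
  ext1 s'
  by_cases h : s' = s
  · subst h; simp
  · rw [Pi.mulSingle_eq_of_ne h, Pi.mulSingle_eq_of_ne h]; rfl

/-- Tensor products of Gaussian unitaries are Gaussian: a generator in a single tensor factor is a
generator, because neighbours within a block are neighbours in the whole system. -/
theorem IsGaussian.blockTensor {V : Fin t → QubitOp n} (hV : ∀ s, IsGaussian (V s)) :
    IsGaussian (blockTensor V) := by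
  choose g hg hgV using hV
  obtain rfl : V = fun s => (g s : QubitOp n) := funext fun s => (hgV s).symm
  refine ⟨blockTensorHom n t g, ?_, rfl⟩
  have key : ∀ s, gaussianGroup n ≤ (gaussianGroup (t * n)).comap
      ((blockTensorHom n t).comp (MonoidHom.mulSingle (fun _ : Fin t => QubitUnitary n) s)) := by
    intro s
    refine (Subgroup.closure_le _).2 fun h hh => ?_
    change blockTensorHom n t (Pi.mulSingle s h) ∈ gaussianGroup (t * n)
    refine Subgroup.subset_closure ?_
    rcases hh with ⟨j, k, hjk, A, hA, B, hB, hAB, h1⟩ | ⟨j, h1⟩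
    · refine Or.inl ⟨finProdFinEquiv (s, j), finProdFinEquiv (s, k), ?_, A, hA, B, hB, hAB, ?_⟩
      · simp only [finProdFinEquiv_apply_val]
        omega
      · rw [coe_blockTensorHom_mulSingle, h1, blockTensor_mulSingle_onPair]
    · refine Or.inr ⟨finProdFinEquiv (s, j), ?_⟩
      rcases h1 with h1 | h1
      · left
        rw [coe_blockTensorHom_mulSingle, h1, blockTensor_mulSingle_onQubit]
      · right
        rw [coe_blockTensorHom_mulSingle, h1, blockTensor_mulSingle_onQubit]
  change g ∈ (gaussianGroup (t * n)).comap (blockTensorHom n t)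
  exact Subgroup.pi_mem_of_mulSingle_mem g fun s => key s (hg s)

end BlockTensor

section Extent

/-! ### The unitary extent of fermionic gates -/

variable {n : ℕ}

/-- A decomposition is optimal if no decomposition has a smaller `ℓ¹` norm. -/
theorem isOptimal_of_forall_le {V : QubitOp n} {ι : Type} [Fintype ι] {c : ι → ℂ}
    {K : ι → QubitOp n} (h : IsFeasible V c K)
    (hle : ∀ (χ : ℕ) (c' : Fin χ → ℂ) (K' : Fin χ → QubitOp n), IsFeasible V c' K' →
      ∑ i, ‖c i‖ ≤ ∑ i, ‖c' i‖) : IsOptimal V c K := by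
  refine ⟨h, ?_⟩
  refine IsLeast.csInf_eq ⟨?_, ?_⟩
  · let e := Fintype.equivFin ι
    refine ⟨Fintype.card ι, c ∘ e.symm, K ∘ e.symm, ⟨fun i => h.1 _, ?_⟩, ?_⟩
    · rw [h.2]
      exact (e.symm.sum_comp fun i => c i • K i).symm
    · congr 1
      exact (e.symm.sum_comp fun i => ‖c i‖).symm
  · rintro r ⟨χ, c', K', h', rfl⟩
    exact pow_le_pow_left₀ (Finset.sum_nonneg fun i _ => norm_nonneg _) (hle χ c' K' h') 2

theorem onPair_rot_zz {j k : Fin n} (hjk : j ≠ k) (c : ℝ) :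
    onPair j k (rot (pauliZ ⊗ₖ pauliZ) c) = Matrix.diagonal fun x =>
      ((Real.cos (c / 2) : ℝ) : ℂ) + -(Complex.I * ((Real.sin (c / 2) : ℝ) : ℂ)) *
        (zSign (x j) * zSign (x k)) := by
  rw [rot_eq zz_mul_self, onPair_add, onPair_smul, onPair_smul, onPair_one, onPair_kronecker hjk,
    pauliZ_eq_diagonal, onQubit_diagonal, onQubit_diagonal, Matrix.diagonal_mul_diagonal,
    ← Matrix.diagonal_one, ← Matrix.diagonal_smul, ← Matrix.diagonal_smul, Matrix.diagonal_add]
  congr 1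
  ext x
  simp

theorem sum_norm_rzzCoeff (c : ℝ) :
    ∑ i, ‖rzzCoeff c i‖ = |Real.cos (c / 2)| + |Real.sin (c / 2)| := by
  simp [rzzCoeff, Fin.sum_univ_two, - Complex.ofReal_cos, - Complex.ofReal_sin]

theorem sq_abs_cos_add_abs_sin (c : ℝ) :
    (|Real.cos (c / 2)| + |Real.sin (c / 2)|) ^ 2 = 1 + |Real.sin c| := by
  have h : Real.sin c = 2 * Real.sin (c / 2) * Real.cos (c / 2) := by
    rw [← Real.sin_two_mul, mul_div_cancel₀ _ two_ne_zero]
  rw [h, abs_mul, abs_mul, abs_two, add_sq, sq_abs, sq_abs]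
  linear_combination Real.cos_sq_add_sin_sq (c / 2)

theorem onPair_canonicalGate_eq_sum (j k : Fin n) (p : Angles) :
    onPair j k (canonicalGate p) = ∑ i, rzzCoeff p.c i • onPair j k (dress p (rzzTerm i)) := by
  rw [canonicalGate_eq_sum, Fin.sum_univ_two, onPair_add, onPair_smul, onPair_smul,
    Fin.sum_univ_two]

theorem isOptimal_onPair {j k : Fin n} (hjk : j ≠ k) {p : Angles}
    (h : ((j : ℕ) + 1 = k ∨ (k : ℕ) + 1 = j) ∨ (canonicalGate p).IsDiag) :
    IsOptimal (onPair j k (canonicalGate p)) (rzzCoeff p.c)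
      (fun i => onPair j k (dress p (rzzTerm i))) := by
  refine isOptimal_of_forall_le
    ⟨isGaussian_onPair_dress hjk h, onPair_canonicalGate_eq_sum j k p⟩ fun χ c' K' h' => ?_
  -- a single gate is the case of one pair of qubits
  have := pow_le_sum_norm (J := fun _ : Unit => j) (K := fun _ => k) (fun _ => hjk)
    (fun s s' hs => absurd rfl hs) (isGaussian_onPair_dress hjk h 0).isFree (by
      rw [canonicalGate_eq_mul, ← onPair_mul hjk, onPair_rot_zz hjk]
      simp only [pairDiagonal, Finset.univ_unique, Finset.prod_singleton]
      rfl) h'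
  rwa [Fintype.card_unit, pow_one, ← sum_norm_rzzCoeff] at this

theorem sum_norm_prod_rzzCoeff (t : ℕ) (c : ℝ) :
    ∑ i : Fin t → Fin 2, ‖∏ s, rzzCoeff c (i s)‖ =
      (|Real.cos (c / 2)| + |Real.sin (c / 2)|) ^ t := by
  simp only [norm_prod]
  rw [← Fintype.piFinset_univ, ← Finset.prod_univ_sum (fun _ => Finset.univ)
    (fun (_ : Fin t) i => ‖rzzCoeff c i‖)]
  simp only [sum_norm_rzzCoeff, Finset.prod_const, Finset.card_univ, Fintype.card_fin]

theorem isOptimal_tensorPower {j k : Fin n} (hjk : j ≠ k) {p : Angles}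
    (h : ((j : ℕ) + 1 = k ∨ (k : ℕ) + 1 = j) ∨ (canonicalGate p).IsDiag) (t : ℕ) :
    IsOptimal (tensorPower t (onPair j k (canonicalGate p)))
      (fun i : Fin t → Fin 2 => ∏ s, rzzCoeff p.c (i s))
      (fun i => blockTensor fun s => onPair j k (dress p (rzzTerm (i s)))) := by
  refine isOptimal_of_forall_le
    ⟨fun i => IsGaussian.blockTensor fun s => isGaussian_onPair_dress hjk h _, ?_⟩
    fun χ c' K' h' => ?_
  · rw [tensorPower, onPair_canonicalGate_eq_sum, blockTensor_sum]
  have := pow_le_sum_norm (J := fun s : Fin t => finProdFinEquiv (s, j))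
    (K := fun s => finProdFinEquiv (s, k)) (fun s => by simpa using hjk)
    (fun s s' hs => by simp [hs])
    (IsGaussian.blockTensor fun _ : Fin t => isGaussian_onPair_dress hjk h 0).isFree (by
      rw [tensorPower, canonicalGate_eq_mul, ← onPair_mul hjk, ← blockTensor_mul,
        onPair_rot_zz hjk, blockTensor_diagonal]
      rfl) h'
  rwa [Fintype.card_fin, ← sum_norm_prod_rzzCoeff] at this

end Extent

end FermionicGates

open FermionicGates
theorem mainTheorem1 (U : TwoQubitOp) (hU : IsFermionicGate U) :
    (∃ p : Angles, U = canonicalGate p) ∧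
    ∀ p : Angles, U = canonicalGate p →
      ∀ (n : ℕ) (j k : Fin n), j ≠ k →
        (((j : ℕ) + 1 = (k : ℕ) ∨ (k : ℕ) + 1 = (j : ℕ)) ∨ U.IsDiag) →
          (unitaryExtent (onPair j k U) = 1 + |Real.sin p.c| ∧
            IsOptimal (onPair j k U) (rzzCoeff p.c)
              (fun i => onPair j k (dress p (rzzTerm i)))) ∧
          ∀ t : ℕ,
            unitaryExtent (tensorPower t (onPair j k U)) = (1 + |Real.sin p.c|) ^ t ∧
            IsOptimal (tensorPower t (onPair j k U))
              (fun i : Fin t → Fin 2 => ∏ s, rzzCoeff p.c (i s))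
              (fun i : Fin t → Fin 2 =>
                blockTensor (fun s => onPair j k (dress p (rzzTerm (i s))))) := by
  refine ⟨hU.exists_eq_canonicalGate, ?_⟩
  rintro p rfl n j k hjk h
  have h1 := isOptimal_onPair hjk h
  refine ⟨⟨?_, h1⟩, fun t => ?_⟩
  · rw [h1.2, sum_norm_rzzCoeff, sq_abs_cos_add_abs_sin]
  have h2 := isOptimal_tensorPower hjk h t
  refine ⟨?_, h2⟩
  rw [h2.2, sum_norm_prod_rzzCoeff, ← pow_mul, mul_comm, pow_mul, sq_abs_cos_add_abs_sin]
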